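/- Let $\mathcal H$ be a complex Hilbert space and $\theta\mapsto|\psi_\theta\rangle\in\mathcal H$ a two-parameter family, $\theta\in\mathbb R^2$, of unit vectors near a point $\theta$ (the true value) at which it is differentiable. Let $\rho_\theta=|\psi_\theta\rangle\langle\psi_\theta|$, let $L_1,L_2$ be symmetric logarithmic derivatives at $\theta$ (bounded self-adjoint operators with $\partial_j\rho=\tfrac12(L_j\rho+\rho L_j)$), and put $J_{jk}=\operatorname{Re}\langle\psi|L_jL_k|\psi\rangle$, $\tilde J_{jk}=\operatorname{Im}\langle\psi|L_jL_k|\psi\rangle$. Assume that the quantum Fisher information matrix $J$ is positive definite. Let $\beta\ge0$ be the absolute value of the eigenvalues of $J^{-1}\tilde J$; then $\beta\le1$, and we put $\eta=\tfrac12\arcsin\beta$. Let $W$ be a real positive semidefinite $2\times2$ weight matrix, and let $s_1,s_2\ge0$ be the eigenvalues, with multiplicity and in any order, of $J^{-1/2}WJ^{-1/2}$. For a discrete POVM $M=(E_i)_i$ with outcome probabilities $p_\theta(i)=\langle\psi_\theta|E_i|\psi_\theta\rangle$ let $F(M)_{jk}=\sum_i \partial_jp(i)\,\partial_kp(i)/p(i)$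 be the classical Fisher information matrix at $\theta$ (outcomes with $p(i)=0$ contribute $0$). The most informative Cramér–Rao bound is $$\mathcal C^{\rm MI}(W)=\inf_M \operatorname{tr}\big[W F(M)^{-1}\big],$$ the infimum being over all POVMs $M$ for which $F(M)$ is nonsingular. Then: 1. The bound is finite and $$\mathcal C^{\rm MI}(W)=\min_{\varphi\in[-\eta,\eta]}\left\{\frac{s_1}{\cos^2(\varphi-\eta)}+\frac{s_2}{\cos^2(\varphi+\eta)}\right\},$$ where the minimum is attained and, for vanishing denominators (possible only if $\beta=1$), $s/0=\infty$ for $s>0$ and $0/0=0$. 2. $\mathcal C^{\rm MI}(W)$ is also the infimum of $\operatorname{tr}[WV]$ over all POVMs and all finite-variance estimators locally unbiased at $\theta$, where $V$ is the mean squared error matrix of the estimator. If $\beta<1$ or $W$ is positive definite, there are a POVM with finitely many outcomes and a locally unbiased estimator for it with $\operatorname{tr}[WF^{-1}]=\operatorname{tr}[WV]=\mathcal C^{\rm MI}(W)$. 3. For every minimizer $\varphi$ in item 1, $x=\tan\varphi$ satisfies $|x|\le\tan\eta$ and $$\begin{aligned}0={}&2(s_2-s_1)\cos\eta\sin^3\eta\;x^4+2(s_1+s_2)(3\cos^2\eta\sin^2\eta+\sin^4\eta)\,x^3\\&-6(s_1-s_2)(\cos^3\eta\sin\eta+\cos\eta\sin^3\eta)\,x^2\\&+2(s_1+s_2)(\cos^4\eta+3\cos^2\eta\sin^2\eta)\,x-2(s_1-s_2)\cos^3\eta\sin\eta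 .\end{aligned}$$ -/

import Mathlib

open Matrix
open scoped InnerProductSpace ENNReal

noncomputable section

namespace TwoParam

variable {H : Type*} [NormedAddCommGroup H] [InnerProductSpace ℂ H] [CompleteSpace H]

/-- A discrete POVM on `H` with outcomes in `ι`: positive operators summing (strongly) to the
identity. -/
structure POVM (ι : Type) (H : Type*) [NormedAddCommGroup H] [InnerProductSpace ℂ H] where
  effect : ι → H →L[ℂ] H
  pos : ∀ i, (effect i).IsPositive
  sum_eq : ∀ x, HasSum (fun i => effect i x) x

/-- The partial derivative `∂_j f` at `θ` of a function of two real parameters. -/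
def pderiv {E : Type*} [NormedAddCommGroup E] [NormedSpace ℝ E]
    (f : (Fin 2 → ℝ) → E) (θ : Fin 2 → ℝ) (j : Fin 2) : E :=
  fderiv ℝ f θ (Pi.single j 1)

/-- The density operator `|ψ⟩⟨ψ|`. -/
def density (ψ : (Fin 2 → ℝ) → H) (θ : Fin 2 → ℝ) : H →L[ℂ] H :=
  InnerProductSpace.rankOne ℂ (ψ θ) (ψ θ)

/-- `L 0, L 1` are symmetric logarithmic derivatives of the model at `θ`:
self-adjoint operators with `∂_j ρ = (L_j ρ + ρ L_j) / 2`. -/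
def IsSLD (ψ : (Fin 2 → ℝ) → H) (θ : Fin 2 → ℝ) (L : Fin 2 → H →L[ℂ] H) : Prop :=
  ∀ j, IsSelfAdjoint (L j) ∧
    pderiv (density ψ) θ j = (1 / 2 : ℂ) • (L j * density ψ θ + density ψ θ * L j)

/-- The quantum Fisher information matrix `J_{jk} = Re ⟨ψ|L_j L_k|ψ⟩`. -/
def qfi (v : H) (L : Fin 2 → H →L[ℂ] H) : Matrix (Fin 2) (Fin 2) ℝ :=
  Matrix.of fun j k => (⟪v, L j (L k v)⟫_ℂ).re

/-- The matrix `J̃_{jk} = Im ⟨ψ|L_j L_k|ψ⟩`. -/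
def qfiIm (v : H) (L : Fin 2 → H →L[ℂ] H) : Matrix (Fin 2) (Fin 2) ℝ :=
  Matrix.of fun j k => (⟪v, L j (L k v)⟫_ℂ).im

/-- The incompatibility `β`: the (largest) modulus of the complex eigenvalues of `J⁻¹ J̃`. -/
def incompat (J Jt : Matrix (Fin 2) (Fin 2) ℝ) : ℝ :=
  (spectralRadius ℂ ((J⁻¹ * Jt).map (fun x : ℝ => (x : ℂ)))).toReal

/-- `J^{-1/2}` for a positive definite `J`, by functional calculus. -/
def invSqrt (J : Matrix (Fin 2) (Fin 2) ℝ) : Matrix (Fin 2) (Fin 2) ℝ :=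
  cfc (fun x : ℝ => (√x)⁻¹) J

variable {ι : Type}

/-- The probability `⟨ψ_θ|E_i|ψ_θ⟩` of the outcome `i`. -/
def prob (ψ : (Fin 2 → ℝ) → H) (M : POVM ι H) (i : ι) (θ : Fin 2 → ℝ) : ℝ :=
  (⟪ψ θ, M.effect i (ψ θ)⟫_ℂ).re

/-- The classical Fisher information matrix `F_{jk} = ∑_i ∂_j p(i) ∂_k p(i) / p(i)`; outcomes of
probability `0` contribute `0`. -/
def fisher (ψ : (Fin 2 → ℝ) → H) (θ : Fin 2 → ℝ) (M : POVM ι H) :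
    Matrix (Fin 2) (Fin 2) ℝ :=
  Matrix.of fun j k =>
    ∑' i, pderiv (prob ψ M i) θ j * pderiv (prob ψ M i) θ k / prob ψ M i θ

open Classical in
/-- The weighted classical Cramér–Rao bound `tr (W F⁻¹)`, infinite if `F` is singular. -/
def classicalBound (W F : Matrix (Fin 2) (Fin 2) ℝ) : ℝ≥0∞ :=
  if F.det = 0 then ⊤ else ENNReal.ofReal (W * F⁻¹).trace

/-- The most informative Cramér–Rao bound: the infimum over all measurements of the classical
Cramér–Rao bound. -/
def mostInformativeBound (ψ : (Fin 2 → ℝ) → H) (θ : Fin 2 → ℝ)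
    (W : Matrix (Fin 2) (Fin 2) ℝ) : ℝ≥0∞ :=
  ⨅ (ι : Type) (M : POVM ι H), classicalBound W (fisher ψ θ M)

/-- `T` is an estimator of finite variance, based on the outcome of `M`, which is locally unbiased
at `θ`: `∑_i p(i) T_j(i) = θ_j` and `∑_i ∂_k p(i) T_j(i) = δ_{jk}`. -/
structure LocallyUnbiased (ψ : (Fin 2 → ℝ) → H) (θ : Fin 2 → ℝ) (M : POVM ι H)
    (T : ι → Fin 2 → ℝ) : Prop where
  finite_variance : ∀ j, Summable fun i => prob ψ M i θ * T i j ^ 2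
  mean : ∀ j, HasSum (fun i => prob ψ M i θ * T i j) (θ j)
  deriv_mean : ∀ j k, HasSum (fun i => pderiv (prob ψ M i) θ k * T i j) (if j = k then 1 else 0)

/-- The mean squared error matrix of the estimator `T` at `θ`. -/
def mse (ψ : (Fin 2 → ℝ) → H) (θ : Fin 2 → ℝ) (M : POVM ι H) (T : ι → Fin 2 → ℝ) :
    Matrix (Fin 2) (Fin 2) ℝ :=
  Matrix.of fun j k => ∑' i, prob ψ M i θ * ((T i j - θ j) * (T i k - θ k))

/-- The smallest weighted error `tr (W V)` (as an infimum) over all measurements and locally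
unbiased estimators. -/
def optimalError (ψ : (Fin 2 → ℝ) → H) (θ : Fin 2 → ℝ)
    (W : Matrix (Fin 2) (Fin 2) ℝ) : ℝ≥0∞ :=
  ⨅ (ι : Type) (M : POVM ι H) (T : ι → Fin 2 → ℝ) (_ : LocallyUnbiased ψ θ M T),
    ENNReal.ofReal (W * mse ψ θ M T).trace

/-- `s₁ / cos² (φ - η) + s₂ / cos² (φ + η)` in `[0, ∞]`, so that `s / 0 = ∞` for `s > 0`
and `0 / 0 = 0`. -/
def objective (s₁ s₂ η φ : ℝ) : ℝ≥0∞ :=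
  ENNReal.ofReal s₁ / ENNReal.ofReal (Real.cos (φ - η) ^ 2) +
    ENNReal.ofReal s₂ / ENNReal.ofReal (Real.cos (φ + η) ^ 2)

/-- The quartic polynomial in `x = tan φ` of the stationarity condition. -/
def quartic (s₁ s₂ η x : ℝ) : ℝ :=
  2 * (s₂ - s₁) * (Real.cos η * Real.sin η ^ 3) * x ^ 4
    + 2 * (s₁ + s₂) * (3 * Real.cos η ^ 2 * Real.sin η ^ 2 + Real.sin η ^ 4) * x ^ 3
    - 6 * (s₁ - s₂) * (Real.cos η ^ 3 * Real.sin η + Real.cos η * Real.sin η ^ 3) * x ^ 2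
    + 2 * (s₁ + s₂) * (Real.cos η ^ 4 + 3 * Real.cos η ^ 2 * Real.sin η ^ 2) * x
    - 2 * (s₁ - s₂) * (Real.cos η ^ 3 * Real.sin η)

end TwoParam

end

/-!
For a measurement `(E_i)` the symmetric logarithmic derivatives enter only through the score
vectors `l_j = L_j ψ`: they are orthogonal to `ψ`, the derivative of the outcome probability is
`∂_j p_i = Re ⟨ψ|E_i|l_j⟩`, and `J`, `J̃` are the real and imaginary parts of their Gram matrix.
A linear change of the two parameters turns `J` into the identity and `W` into
`diag (s₁, s₂)`, and then `J̃` becomes `β` times a rotation by a right angle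
(`exists_normal_coordinates`). The score vectors become unit vectors `e₁, e₂` with
`⟨e₁|e₂⟩ = i β`, where `β = sin 2η` (`NormalForm`).

*Lower bound.* Let `f₁, f₂` be the diagonal entries of the classical Fisher information matrix in
these coordinates, so that `tr (W F⁻¹) ≥ s₁ / f₁ + s₂ / f₂`. The Cauchy–Schwarz inequality for each
effect `E_i`, applied to `ψ` and `e₁ + i b e₂`, gives after summation
`2 β ≤ a f₁ + (1 - f₂) / a + b f₂ + (1 - f₁) / b` for all `a, b > 0` with `a b ≤ 1`
(`fisherForm_tradeoff`). Writing `f_j = cos² α_j`, the choice `a = sin α₂ / cos α₁`,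
`b = sin α₁ / cos α₂` makes the right-hand side `2 sin (α₁ + α₂)`, and the inequality says that
`α₁ + α₂ ≥ 2η`. Hence `f₁ ≤ cos² (φ - η)` and `f₂ ≤ cos² (φ + η)` for some `φ ∈ [-η, η]`
(`exists_angle`).

*Attainability.* Given `φ`, put `α₁ = η - φ` and `α₂ = η + φ`. If `g₁, g₂` are orthogonal to `ψ`,
satisfy Bessel's inequality, and have `Re ⟨g_j|e_k⟩ = δ_jk cos α_j`, then the measurement along a
real rotation of the frame `ψ, g₁, g₂` has Fisher information `diag (cos² α₁, cos² α₂)`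
(`fisherForm_framePOVM`). Such vectors lie in the span of `e₁, e₂`: an orthonormal pair if `β < 1`,
and multiples of `e₁, e₂` if `β = 1` (`exists_measurement_vectors`). The values of `φ` with a
vanishing denominator are reached by continuity.

The estimation error is compared with `tr (W F⁻¹)` by the classical Cramér–Rao inequality, with
equality for the estimator `θ + F⁻¹ ∂p / p`. A minimizing `φ` is either stationary, which is the
quartic equation for `tan φ`, or an end point of `[-η, η]`, where the one-sided derivative forces
one of `s₁, s₂` to vanish, and the quartic equation holds trivially.
-/

noncomputable section

namespace TwoParam

variable {H : Type*} [NormedAddCommGroup H] [InnerProductSpace ℂ H]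

/-! ### Score vectors of the model -/

section Model

/-- `(x, y) ↦ |x⟩⟨y|` is real bilinear, although it is only sesquilinear over `ℂ`. -/
lemma isBoundedBilinearMap_rankOne :
    IsBoundedBilinearMap ℝ
      (fun p : H × H => (InnerProductSpace.rankOne ℂ p.1 p.2 : H →L[ℂ] H)) where
  add_left x y z := by simp
  smul_left c x y := by
    ext z
    simp only [← Complex.coe_smul c x, map_smul]
    rfl
  add_right x y z := by simp
  smul_right c x y := by
    ext z
    simp [InnerProductSpace.rankOne_apply, inner_smul_left_eq_smul, mul_smul]
  bound := ⟨1, one_pos, fun x y => by simp⟩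

variable {ψ : (Fin 2 → ℝ) → H} {θ : Fin 2 → ℝ}

lemma pderiv_density_apply (hdiff : DifferentiableAt ℝ ψ θ) (j : Fin 2) (x : H) :
    pderiv (density ψ) θ j x
      = ⟪ψ θ, x⟫_ℂ • pderiv ψ θ j + ⟪pderiv ψ θ j, x⟫_ℂ • ψ θ := by
  have h := (isBoundedBilinearMap_rankOne.hasFDerivAt (ψ θ, ψ θ)).comp (f := fun ϑ => (ψ ϑ, ψ ϑ)) θ
    (hdiff.hasFDerivAt.prodMk hdiff.hasFDerivAt)
  have h2 : HasFDerivAt (density ψ) _ θ := h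
  simp [pderiv, h2.fderiv, add_comm]

/-- Differentiating `‖ψ‖² = 1`. -/
lemma re_inner_pderiv (hnorm : ∀ᶠ ϑ in nhds θ, ‖ψ ϑ‖ = 1) (hdiff : DifferentiableAt ℝ ψ θ)
    (j : Fin 2) : (⟪ψ θ, pderiv ψ θ j⟫_ℂ).re = 0 := by
  have h1 : HasFDerivAt (fun ϑ => ⟪ψ ϑ, ψ ϑ⟫_ℂ) _ θ :=
    hdiff.hasFDerivAt.inner ℂ hdiff.hasFDerivAt
  have h2 : (fun ϑ => ⟪ψ ϑ, ψ ϑ⟫_ℂ) =ᶠ[nhds θ] fun _ => (1 : ℂ) := by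
    filter_upwards [hnorm] with ϑ h
    rw [inner_self_eq_norm_sq_to_K, h]; simp
  have h3 := (h1.congr_of_eventuallyEq h2.symm).unique (hasFDerivAt_const (1 : ℂ) θ)
  have h4 := congrArg Complex.re (DFunLike.congr_fun h3 (Pi.single j 1))
  have h5 : (⟪pderiv ψ θ j, ψ θ⟫_ℂ).re = (⟪ψ θ, pderiv ψ θ j⟫_ℂ).re := inner_re_symm (𝕜 := ℂ) _ _
  simp [fderivInnerCLM_apply] at h4
  simp only [pderiv] at h5 ⊢
  linarith

lemma pderiv_prob_eq {ι : Type} (M : POVM ι H) (hdiff : DifferentiableAt ℝ ψ θ) (i : ι)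
    (j : Fin 2) :
    pderiv (prob ψ M i) θ j = 2 * (⟪ψ θ, M.effect i (pderiv ψ θ j)⟫_ℂ).re := by
  have h0 : HasFDerivAt (fun ϑ => M.effect i (ψ ϑ)) _ θ :=
    ((M.effect i).restrictScalars ℝ).hasFDerivAt.comp θ hdiff.hasFDerivAt
  have h1 : HasFDerivAt (fun ϑ => ⟪ψ ϑ, M.effect i (ψ ϑ)⟫_ℂ) _ θ := hdiff.hasFDerivAt.inner ℂ h0
  have h2 : HasFDerivAt (prob ψ M i) _ θ := (Complex.reCLM.hasFDerivAt).comp θ h1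
  have h3 : (⟪fderiv ℝ ψ θ (Pi.single j 1), M.effect i (ψ θ)⟫_ℂ).re
      = (⟪ψ θ, M.effect i (fderiv ℝ ψ θ (Pi.single j 1))⟫_ℂ).re := by
    rw [← (M.pos i).inner_left_eq_inner_right]; exact inner_re_symm (𝕜 := ℂ) _ _
  simp only [pderiv, h2.fderiv]
  simp [fderivInnerCLM_apply, h3]
  ring

variable [CompleteSpace H] {L : Fin 2 → H →L[ℂ] H}

/-- Evaluating the equation of the symmetric logarithmic derivative at the state itself. -/
lemma IsSLD.pderiv_eq (hL : IsSLD ψ θ L) (h1 : ‖ψ θ‖ = 1) (hdiff : DifferentiableAt ℝ ψ θ)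
    (j : Fin 2) :
    pderiv ψ θ j + ⟪pderiv ψ θ j, ψ θ⟫_ℂ • ψ θ
      = (1 / 2 : ℂ) • (L j (ψ θ) + ⟪ψ θ, L j (ψ θ)⟫_ℂ • ψ θ) := by
  have h := DFunLike.congr_fun (hL j).2 (ψ θ)
  rw [pderiv_density_apply hdiff] at h
  simpa [density, InnerProductSpace.rankOne_apply, inner_self_eq_norm_sq_to_K, h1] using h

lemma IsSLD.inner_apply_left (hL : IsSLD ψ θ L) (j : Fin 2) (x y : H) :
    ⟪L j x, y⟫_ℂ = ⟪x, L j y⟫_ℂ :=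
  (ContinuousLinearMap.isSelfAdjoint_iff_isSymmetric.mp (hL j).1) x y

/-- The score vectors `L_j ψ` are orthogonal to the state. -/
lemma IsSLD.inner_apply_self (hL : IsSLD ψ θ L) (hnorm : ∀ᶠ ϑ in nhds θ, ‖ψ ϑ‖ = 1)
    (hdiff : DifferentiableAt ℝ ψ θ) (j : Fin 2) : ⟪ψ θ, L j (ψ θ)⟫_ℂ = 0 := by
  have hn := hnorm.self_of_nhds
  have h := congrArg (fun x => ⟪ψ θ, x⟫_ℂ) (hL.pderiv_eq hn hdiff j)
  have hc : ⟪ψ θ, ψ θ⟫_ℂ = 1 := by rw [inner_self_eq_norm_sq_to_K, hn]; simp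
  simp only [inner_add_right, inner_smul_right, hc] at h
  have hr := re_inner_pderiv hnorm hdiff j
  have h5 : ⟪pderiv ψ θ j, ψ θ⟫_ℂ = star ⟪ψ θ, pderiv ψ θ j⟫_ℂ := (inner_conj_symm _ _).symm
  rw [h5] at h
  have h6 : ⟪ψ θ, pderiv ψ θ j⟫_ℂ + star ⟪ψ θ, pderiv ψ θ j⟫_ℂ = 0 := by
    rw [Complex.star_def, Complex.add_conj, hr]; simp
  linear_combination (-1 : ℂ) * h + h6

/-- Up to a phase rotation the derivative of the state is half the score vector; the phase does
not affect the outcome probabilities. -/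
lemma IsSLD.pderiv_prob {ι : Type} (hL : IsSLD ψ θ L) (hnorm : ∀ᶠ ϑ in nhds θ, ‖ψ ϑ‖ = 1)
    (hdiff : DifferentiableAt ℝ ψ θ) (M : POVM ι H) (i : ι) (j : Fin 2) :
    pderiv (prob ψ M i) θ j = (⟪ψ θ, M.effect i (L j (ψ θ))⟫_ℂ).re := by
  have hn := hnorm.self_of_nhds
  have h := hL.pderiv_eq hn hdiff j
  rw [hL.inner_apply_self hnorm hdiff j, zero_smul, add_zero] at h
  have h2 := congrArg (fun x => (⟪ψ θ, M.effect i x⟫_ℂ).re) h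
  have hr := re_inner_pderiv hnorm hdiff j
  have h5 : (⟪pderiv ψ θ j, ψ θ⟫_ℂ).re = 0 := by
    rw [← hr]; exact inner_re_symm (𝕜 := ℂ) _ _
  have h6 : (⟪ψ θ, M.effect i (ψ θ)⟫_ℂ).im = 0 := by
    have := (M.pos i).inner_nonneg_right (ψ θ)
    exact ((Complex.le_def.mp this).2).symm
  have h7 : ((1 : ℂ) / 2) = ((1 / 2 : ℝ) : ℂ) := by push_cast; rfl
  simp only [map_add, map_smul, inner_add_right, inner_smul_right, Complex.add_re, Complex.mul_re,
    h5, h6, h7, Complex.ofReal_re, Complex.ofReal_im] at h2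
  rw [pderiv_prob_eq M hdiff]
  linarith

end Model

/-! ### The trade-off for a single outcome -/

section Positive

variable {E : H →L[ℂ] H}

lemma inner_apply_re_symm (hE : E.IsPositive) (x y : H) :
    (⟪y, E x⟫_ℂ).re = (⟪x, E y⟫_ℂ).re := by
  rw [← hE.inner_left_eq_inner_right]; exact inner_re_symm (𝕜 := ℂ) _ _

lemma inner_apply_im_symm (hE : E.IsPositive) (x y : H) :
    (⟪y, E x⟫_ℂ).im = -(⟪x, E y⟫_ℂ).im := by
  rw [← hE.inner_left_eq_inner_right]; exact inner_im_symm (𝕜 := ℂ) _ _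

lemma inner_apply_self_re_nonneg (hE : E.IsPositive) (x : H) : 0 ≤ (⟪x, E x⟫_ℂ).re :=
  (Complex.le_def.mp (hE.inner_nonneg_right x)).1

lemma inner_apply_self_im (hE : E.IsPositive) (x : H) : (⟪x, E x⟫_ℂ).im = 0 :=
  (Complex.le_def.mp (hE.inner_nonneg_right x)).2.symm

/-- The Cauchy–Schwarz inequality for the semi-inner product of a positive operator. -/
lemma cauchySchwarz (hE : E.IsPositive) (v x : H) :
    (⟪v, E x⟫_ℂ).re ^ 2 + (⟪v, E x⟫_ℂ).im ^ 2 ≤ (⟪v, E v⟫_ℂ).re * (⟪x, E x⟫_ℂ).re := by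
  set z := ⟪v, E x⟫_ℂ with hz
  set p := (⟪v, E v⟫_ℂ).re with hp
  set n := (⟪x, E x⟫_ℂ).re with hn
  -- positivity of the form at `x - c z v`
  have key (c : ℝ) : 0 ≤ n - 2 * c * (z.re ^ 2 + z.im ^ 2) + c ^ 2 * p * (z.re ^ 2 + z.im ^ 2) := by
    have h := inner_apply_self_re_nonneg hE (x - ((c : ℂ) * z) • v)
    have e1 := inner_apply_re_symm hE x v
    have e2 := inner_apply_im_symm hE x v
    have e3 := inner_apply_self_im hE v
    have e : (⟪x - ((c : ℂ) * z) • v, E (x - ((c : ℂ) * z) • v)⟫_ℂ).re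
        = n - 2 * c * (z.re ^ 2 + z.im ^ 2) + c ^ 2 * p * (z.re ^ 2 + z.im ^ 2) := by
      simp only [map_sub, map_smul, inner_sub_left, inner_sub_right, inner_smul_left,
        inner_smul_right, Complex.sub_re, Complex.sub_im, Complex.mul_re, Complex.mul_im, map_mul,
        Complex.conj_re, Complex.conj_im, Complex.conj_ofReal, Complex.ofReal_re,
        Complex.ofReal_im]
      rw [← hz, ← hp, ← hn, e3]
      rw [← hz] at e1 e2
      have e2' : (⟪x, E v⟫_ℂ).im = -z.im := by linarith
      rw [← e1, e2']
      ring
    linarith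
  have hp0 : 0 ≤ p := inner_apply_self_re_nonneg hE v
  -- if `p = 0`, the bound `key` is affine in `c`, which forces `z = 0`
  rcases hp0.eq_or_lt with h0 | h0
  · rw [← h0, zero_mul]
    by_contra hneg
    push Not at hneg
    have h := key ((n + 1) / (2 * (z.re ^ 2 + z.im ^ 2)))
    rw [← h0] at h
    field_simp at h
    nlinarith
  · have h := key (1 / p)
    field_simp at h
    nlinarith

/-- The trade-off between the information about two directions `x`, `y` gained from a single
outcome. It is the Cauchy–Schwarz inequality for the direction `x + i b y`. -/
lemma effect_tradeoff (hE : E.IsPositive) (v x y : H) {a b : ℝ} (ha : 0 < a) (hb : 0 < b)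
    (hab : a * b ≤ 1) :
    2 * (⟪x, E y⟫_ℂ).im ≤
      a * ((⟪v, E x⟫_ℂ).re ^ 2 / (⟪v, E v⟫_ℂ).re)
        + a⁻¹ * ((⟪y, E y⟫_ℂ).re - (⟪v, E y⟫_ℂ).re ^ 2 / (⟪v, E v⟫_ℂ).re)
        + b * ((⟪v, E y⟫_ℂ).re ^ 2 / (⟪v, E v⟫_ℂ).re)
        + b⁻¹ * ((⟪x, E x⟫_ℂ).re - (⟪v, E x⟫_ℂ).re ^ 2 / (⟪v, E v⟫_ℂ).re) := by
  have h1 := cauchySchwarz hE v (x + ((b : ℂ) * Complex.I) • y)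
  have h2 := cauchySchwarz hE v y
  have h3 := cauchySchwarz hE v x
  have hs1 := inner_apply_re_symm hE x y
  have hs2 := inner_apply_im_symm hE x y
  have hn2 := inner_apply_self_re_nonneg hE y
  have hp := inner_apply_self_re_nonneg hE v
  simp only [map_add, map_smul, inner_add_left, inner_add_right, inner_smul_left,
    inner_smul_right, Complex.add_re, Complex.add_im, Complex.mul_re, Complex.mul_im, map_mul,
    Complex.conj_ofReal, Complex.ofReal_re,
    Complex.ofReal_im, Complex.conj_I, Complex.neg_re, Complex.neg_im, Complex.I_re,
    Complex.I_im, hs1, hs2, inner_apply_self_im hE y] at h1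
  set p := (⟪v, E v⟫_ℂ).re
  set n₁ := (⟪x, E x⟫_ℂ).re
  set n₂ := (⟪y, E y⟫_ℂ).re
  set u₁ := (⟪v, E x⟫_ℂ).re
  set u₂ := (⟪v, E y⟫_ℂ).re
  set w₁ := (⟪v, E x⟫_ℂ).im
  set w₂ := (⟪v, E y⟫_ℂ).im
  set t := (⟪x, E y⟫_ℂ).im
  have hab' : b ≤ a⁻¹ := by rw [le_inv_comm₀ hb ha, ← one_div, le_div_iff₀ hb]; exact hab
  have hn : b * n₂ ≤ a⁻¹ * n₂ := mul_le_mul_of_nonneg_right hab' hn2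
  have h1' : (u₁ - b * w₂) ^ 2 + (w₁ + b * u₂) ^ 2 ≤ p * (n₁ + b ^ 2 * n₂ - 2 * b * t) := by
    nlinarith
  rcases hp.eq_or_lt with h0 | h0
  -- an outcome of probability zero: the quotients by `p` are zero, and positivity of `E` at
  -- `x + i b y` suffices
  · rw [← h0] at h1' ⊢
    have hsq : 0 ≤ n₁ + b ^ 2 * n₂ - 2 * b * t := by
      have h := inner_apply_self_re_nonneg hE (x + ((b : ℂ) * Complex.I) • y)
      simp only [map_add, map_smul, inner_add_left, inner_add_right, inner_smul_left,
        inner_smul_right, Complex.add_re, Complex.add_im, Complex.mul_re, Complex.mul_im, map_mul,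
        Complex.conj_ofReal, Complex.ofReal_re,
        Complex.ofReal_im, Complex.conj_I, Complex.neg_re, Complex.neg_im, Complex.I_re,
        Complex.I_im, hs1, hs2, inner_apply_self_im hE y] at h
      simp only [n₁, n₂, t]
      linarith
    have : 2 * t ≤ b⁻¹ * n₁ + b * n₂ := by
      have := mul_nonneg (inv_nonneg.mpr hb.le) hsq
      field_simp at this ⊢
      linarith
    simp only [div_zero, mul_zero, sub_zero]
    linarith
  · have hq : ((u₁ - b * w₂) ^ 2 + (w₁ + b * u₂) ^ 2) / p ≤ n₁ + b ^ 2 * n₂ - 2 * b * t := by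
      rw [div_le_iff₀ h0]; linarith
    have hr : 2 * t ≤ b⁻¹ * n₁ + b * n₂ - b⁻¹ * (((u₁ - b * w₂) ^ 2 + (w₁ + b * u₂) ^ 2) / p) := by
      have := mul_le_mul_of_nonneg_left hq (inv_nonneg.mpr hb.le)
      have e : b⁻¹ * (n₁ + b ^ 2 * n₂ - 2 * b * t) = b⁻¹ * n₁ + b * n₂ - 2 * t := by field_simp
      linarith
    have hn₂ : (u₂ ^ 2 + w₂ ^ 2) / p ≤ n₂ := by rw [div_le_iff₀ h0]; linarith
    have hd := mul_le_mul_of_nonneg_left hn₂ (sub_nonneg.mpr hab')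
    -- the difference of the two sides, up to what was estimated, is a sum of squares
    have hid : a * (u₁ ^ 2 / p) - a⁻¹ * (u₂ ^ 2 / p) + b * (u₂ ^ 2 / p) - b⁻¹ * (u₁ ^ 2 / p)
        + (a⁻¹ - b) * ((u₂ ^ 2 + w₂ ^ 2) / p)
        + b⁻¹ * (((u₁ - b * w₂) ^ 2 + (w₁ + b * u₂) ^ 2) / p)
        = (a⁻¹ * (w₂ - a * u₁) ^ 2 + b⁻¹ * (w₁ + b * u₂) ^ 2) / p := by
      field_simp
      ring
    have hpos : 0 ≤ (a⁻¹ * (w₂ - a * u₁) ^ 2 + b⁻¹ * (w₁ + b * u₂) ^ 2) / p := by positivity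
    nlinarith

end Positive

/-! ### The Fisher information as a bilinear form on score vectors -/

section FisherForm

variable {ι : Type} (M : POVM ι H) (v : H)

lemma POVM.hasSum_inner (x y : H) : HasSum (fun i => ⟪x, M.effect i y⟫_ℂ) ⟪x, y⟫_ℂ :=
  (innerSL ℂ x).hasSum (M.sum_eq y)

lemma POVM.hasSum_inner_re (x y : H) :
    HasSum (fun i => (⟪x, M.effect i y⟫_ℂ).re) (⟪x, y⟫_ℂ).re :=
  Complex.hasSum_re (M.hasSum_inner x y)

lemma POVM.hasSum_inner_im (x y : H) :
    HasSum (fun i => (⟪x, M.effect i y⟫_ℂ).im) (⟪x, y⟫_ℂ).im :=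
  Complex.hasSum_im (M.hasSum_inner x y)

/-- The classical Fisher information of the measurement `M` as a real bilinear form on score
vectors: a score vector `x` changes the probability of the outcome `i` at the rate
`Re ⟨v|E_i|x⟩`. -/
def fisherForm (x y : H) : ℝ :=
  ∑' i, (⟪v, M.effect i x⟫_ℂ).re * (⟪v, M.effect i y⟫_ℂ).re / (⟪v, M.effect i v⟫_ℂ).re

lemma sq_div_le (i : ι) (x : H) :
    (⟪v, M.effect i x⟫_ℂ).re ^ 2 / (⟪v, M.effect i v⟫_ℂ).re ≤ (⟪x, M.effect i x⟫_ℂ).re := by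
  have h := cauchySchwarz (M.pos i) v x
  have hn := inner_apply_self_re_nonneg (M.pos i) x
  rcases (inner_apply_self_re_nonneg (M.pos i) v).eq_or_lt with h0 | h0
  · rw [← h0, div_zero]; exact hn
  · rw [div_le_iff₀ h0]; nlinarith [sq_nonneg (⟪v, M.effect i x⟫_ℂ).im]

lemma summable_fisher_self (x : H) :
    Summable fun i => (⟪v, M.effect i x⟫_ℂ).re ^ 2 / (⟪v, M.effect i v⟫_ℂ).re :=
  Summable.of_nonneg_of_le
    (fun i => div_nonneg (sq_nonneg _) (inner_apply_self_re_nonneg (M.pos i) v))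
    (fun i => sq_div_le M v i x) (M.hasSum_inner_re x x).summable

lemma summable_fisher (x y : H) :
    Summable fun i =>
      (⟪v, M.effect i x⟫_ℂ).re * (⟪v, M.effect i y⟫_ℂ).re / (⟪v, M.effect i v⟫_ℂ).re := by
  refine (((summable_fisher_self M v (x + y)).sub (summable_fisher_self M v x)).sub
    (summable_fisher_self M v y)).mul_left (1 / 2) |>.congr fun i => ?_
  simp only [map_add, inner_add_right, Complex.add_re]
  ring

lemma fisherForm_self (x : H) :
    fisherForm M v x x = ∑' i, (⟪v, M.effect i x⟫_ℂ).re ^ 2 / (⟪v, M.effect i v⟫_ℂ).re := by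
  simp only [fisherForm, sq]

lemma fisherForm_self_le (x : H) : fisherForm M v x x ≤ (⟪x, x⟫_ℂ).re := by
  rw [fisherForm_self, ← (M.hasSum_inner_re x x).tsum_eq]
  exact (summable_fisher_self M v x).tsum_le_tsum (fun i => sq_div_le M v i x)
    (M.hasSum_inner_re x x).summable

lemma fisherForm_symm (x y : H) : fisherForm M v x y = fisherForm M v y x := by
  simp only [fisherForm, mul_comm]

lemma fisherForm_add_left (x y z : H) :
    fisherForm M v (x + y) z = fisherForm M v x z + fisherForm M v y z := by
  rw [fisherForm, fisherForm, fisherForm,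
    ← (summable_fisher M v x z).tsum_add (summable_fisher M v y z)]
  refine tsum_congr fun i => ?_
  simp only [map_add, inner_add_right, Complex.add_re]
  ring

lemma fisherForm_smul_left (c : ℝ) (x z : H) :
    fisherForm M v ((c : ℂ) • x) z = c * fisherForm M v x z := by
  rw [fisherForm, fisherForm, ← tsum_mul_left]
  refine tsum_congr fun i => ?_
  simp only [map_smul, inner_smul_right, Complex.re_ofReal_mul]
  ring

lemma fisherForm_sum_sum (l : Fin 2 → H) (A : Matrix (Fin 2) (Fin 2) ℝ) (j k : Fin 2) :
    fisherForm M v (∑ a, (A a j : ℂ) • l a) (∑ b, (A b k : ℂ) • l b)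
      = (Aᵀ * (Matrix.of fun a b => fisherForm M v (l a) (l b)) * A) j k := by
  have hr (x : H) (c : ℝ) (z : H) : fisherForm M v z ((c : ℂ) • x) = c * fisherForm M v z x := by
    rw [fisherForm_symm, fisherForm_smul_left, fisherForm_symm]
  have ha (x y z : H) : fisherForm M v z (x + y) = fisherForm M v z x + fisherForm M v z y := by
    rw [fisherForm_symm, fisherForm_add_left, fisherForm_symm M v x, fisherForm_symm M v y]
  simp only [Fin.sum_univ_two, fisherForm_add_left, fisherForm_smul_left, hr, ha, Matrix.mul_apply,
    Matrix.transpose_apply, Matrix.of_apply]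
  ring

/-- The trade-off between the classical Fisher informations about two directions. -/
lemma fisherForm_tradeoff (x y : H) {a b : ℝ} (ha : 0 < a) (hb : 0 < b) (hab : a * b ≤ 1) :
    2 * (⟪x, y⟫_ℂ).im ≤ a * fisherForm M v x x + a⁻¹ * ((⟪y, y⟫_ℂ).re - fisherForm M v y y)
      + b * fisherForm M v y y + b⁻¹ * ((⟪x, x⟫_ℂ).re - fisherForm M v x x) := by
  have hx := (summable_fisher_self M v x).hasSum
  have hy := (summable_fisher_self M v y).hasSum
  rw [← fisherForm_self] at hx hy
  exact hasSum_le (fun i => effect_tradeoff (M.pos i) v x y ha hb hab)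
    ((M.hasSum_inner_im x y).mul_left 2)
    ((((hx.mul_left a).add (((M.hasSum_inner_re y y).sub hy).mul_left a⁻¹)).add
      (hy.mul_left b)).add (((M.hasSum_inner_re x x).sub hx).mul_left b⁻¹))

end FisherForm

/-! ### Normal coordinates -/

section Normalization

lemma isHermitian_invSqrt (J : Matrix (Fin 2) (Fin 2) ℝ) : (invSqrt J).IsHermitian :=
  cfc_predicate (R := ℝ) (p := IsSelfAdjoint) _ J

lemma invSqrt_mul_mul_invSqrt {J : Matrix (Fin 2) (Fin 2) ℝ} (hJ : J.PosDef) :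
    invSqrt J * J * invSqrt J = 1 := by
  have hsa : IsSelfAdjoint J := hJ.isHermitian
  have hc (f : ℝ → ℝ) : ContinuousOn f (spectrum ℝ J) := by
    rw [hJ.isHermitian.spectrum_real_eq_range_eigenvalues]
    exact (Set.finite_range _).continuousOn f
  have h1 : invSqrt J * J * invSqrt J
      = cfc (fun x : ℝ => (√x)⁻¹ * id x * (√x)⁻¹) J := by
    rw [cfc_mul _ _ J (hc _) (hc _), cfc_mul _ _ J (hc _) (hc _), cfc_id ℝ J hsa]
    rfl
  rw [h1, ← cfc_const_one ℝ J hsa]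
  refine cfc_congr fun x hx => ?_
  rw [hJ.isHermitian.spectrum_real_eq_range_eigenvalues] at hx
  obtain ⟨i, rfl⟩ := hx
  have hpos := hJ.eigenvalues_pos i
  have hs := Real.sq_sqrt hpos.le
  have hs0 := Real.sqrt_pos.mpr hpos
  simp only [id]
  field_simp
  exact hs.symm

/-- A real symmetric `2 × 2` matrix is diagonalized by an orthogonal matrix, with the eigenvalues
in any prescribed order. -/
lemma exists_orthogonal_diagonal {K : Matrix (Fin 2) (Fin 2) ℝ} (hK : K.IsHermitian) {s₁ s₂ : ℝ}
    (hs : K.charpoly.roots = {s₁, s₂}) :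
    ∃ U : Matrix (Fin 2) (Fin 2) ℝ, Uᵀ * U = 1 ∧ Uᵀ * K * U = !![s₁, 0; 0, s₂] := by
  have hU : (hK.eigenvectorUnitary : Matrix (Fin 2) (Fin 2) ℝ)ᵀ * hK.eigenvectorUnitary = 1 := by
    have := Unitary.coe_star_mul_self hK.eigenvectorUnitary
    rwa [Matrix.star_eq_conjTranspose, Matrix.conjTranspose_eq_transpose_of_trivial] at this
  have hD : (hK.eigenvectorUnitary : Matrix (Fin 2) (Fin 2) ℝ)ᵀ * K * hK.eigenvectorUnitary
      = !![hK.eigenvalues 0, 0; 0, hK.eigenvalues 1] := by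
    have := hK.conjStarAlgAut_star_eigenvectorUnitary
    rw [Unitary.conjStarAlgAut_star_apply, Matrix.star_eq_conjTranspose,
      Matrix.conjTranspose_eq_transpose_of_trivial] at this
    rw [this]
    ext i j
    fin_cases i <;> fin_cases j <;> simp
  set U := (hK.eigenvectorUnitary : Matrix (Fin 2) (Fin 2) ℝ)
  rw [hK.roots_charpoly_eq_eigenvalues] at hs
  have hs' : ({hK.eigenvalues 0, hK.eigenvalues 1} : Multiset ℝ) = {s₁, s₂} := by
    rw [← hs]; simp [Fin.univ_val_map, List.ofFn]; rfl
  have hcases : (hK.eigenvalues 0 = s₁ ∧ hK.eigenvalues 1 = s₂)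
      ∨ (hK.eigenvalues 0 = s₂ ∧ hK.eigenvalues 1 = s₁) := by
    have h := hs'
    simp only [Multiset.insert_eq_cons, Multiset.cons_eq_cons, Multiset.singleton_inj] at h
    rcases h with h | ⟨-, c, h1, h2⟩
    · exact Or.inl h
    · right
      have e1 := congrArg Multiset.card h1
      simp at e1
      subst e1
      simp at h1 h2
      exact ⟨h2.symm, h1⟩
  rcases hcases with ⟨h1, h2⟩ | ⟨h1, h2⟩
  · exact ⟨U, hU, by rw [hD, h1, h2]⟩
  · refine ⟨U * !![0, 1; 1, 0], ?_, ?_⟩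
    · calc (U * !![0, 1; 1, 0])ᵀ * (U * !![0, 1; 1, 0])
          = (!![0, 1; 1, 0] : Matrix (Fin 2) (Fin 2) ℝ)ᵀ * (Uᵀ * U) * !![0, 1; 1, 0] := by
            simp only [Matrix.transpose_mul, Matrix.mul_assoc]
        _ = 1 := by
            rw [hU]; ext i j; fin_cases i <;> fin_cases j <;> simp [Matrix.mul_apply]
    · calc (U * !![0, 1; 1, 0])ᵀ * K * (U * !![0, 1; 1, 0])
          = (!![0, 1; 1, 0] : Matrix (Fin 2) (Fin 2) ℝ)ᵀ * (Uᵀ * K * U) * !![0, 1; 1, 0] := by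
            simp only [Matrix.transpose_mul, Matrix.mul_assoc]
        _ = _ := by
            rw [hD, h1, h2]
            ext i j; fin_cases i <;> fin_cases j <;> simp [Matrix.mul_apply]

/-- In coordinates in which `J` is the identity, `J̃` is `b` times the rotation by a right angle,
with eigenvalues `± i b`. -/
lemma incompat_eq_abs {J Jt A : Matrix (Fin 2) (Fin 2) ℝ} {b : ℝ} (hJ : Aᵀ * J * A = 1)
    (hJt : Aᵀ * Jt * A = !![0, b; -b, 0]) : incompat J Jt = |b| := by
  have hA : A * (Aᵀ * J) = 1 := mul_eq_one_comm.mp hJ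
  have hAJ : (A * Aᵀ) * J = 1 := by rw [Matrix.mul_assoc]; exact hA
  have hJinv : J⁻¹ = A * Aᵀ := Matrix.inv_eq_left_inv hAJ
  have htr : (J⁻¹ * Jt).trace = 0 := by
    rw [hJinv, Matrix.mul_assoc, Matrix.trace_mul_comm, hJt]
    simp [Matrix.trace_fin_two]
  have hdet : (J⁻¹ * Jt).det = b ^ 2 := by
    have h := congrArg Matrix.det hJt
    rw [hJinv]
    simp only [Matrix.det_mul, Matrix.det_fin_two_of] at h ⊢
    linear_combination h
  have hspec : spectrum ℂ ((J⁻¹ * Jt).map (fun x : ℝ => (x : ℂ)))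
      = {(b : ℂ) * Complex.I, -((b : ℂ) * Complex.I)} := by
    ext z
    have hd : (Complex.ofRealHom (J⁻¹ * Jt).det)
        = ((J⁻¹ * Jt).map (fun x : ℝ => (x : ℂ))).det := RingHom.map_det _ _
    have ht : ((J⁻¹ * Jt).map (fun x : ℝ => (x : ℂ))).trace = ((J⁻¹ * Jt).trace : ℂ) := by
      simp [Matrix.trace_fin_two]
    rw [Matrix.mem_spectrum_iff_isRoot_charpoly, Matrix.charpoly_fin_two, ← hd, ht, htr, hdet]
    simp only [Polynomial.IsRoot.def, Polynomial.eval_add, Polynomial.eval_sub,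
      Polynomial.eval_mul, Polynomial.eval_pow, Polynomial.eval_X, Polynomial.eval_C,
      Set.mem_insert_iff, Set.mem_singleton_iff]
    have hfac : z ^ 2 - ((0 : ℝ) : ℂ) * z + Complex.ofRealHom (b ^ 2)
        = (z - b * Complex.I) * (z + b * Complex.I) := by
      have := Complex.I_sq
      simp only [Complex.ofRealHom_eq_coe]
      push_cast
      linear_combination (b : ℂ) ^ 2 * this
    rw [hfac, mul_eq_zero, sub_eq_zero, add_eq_zero_iff_eq_neg]
  rw [incompat, spectralRadius, hspec, iSup_insert, iSup_singleton]
  simp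

/-- Coordinates in which the quantum Fisher information matrix is the identity, the weight is
diagonal, and `J̃` is the canonical antisymmetric matrix of size `β`. -/
lemma exists_normal_coordinates {J Jt W : Matrix (Fin 2) (Fin 2) ℝ} (hJ : J.PosDef)
    (hJt : Jtᵀ = -Jt) (hW : W.IsHermitian) {s₁ s₂ : ℝ}
    (hs : (invSqrt J * W * invSqrt J).charpoly.roots = {s₁, s₂}) :
    ∃ A : Matrix (Fin 2) (Fin 2) ℝ, Aᵀ * J * A = 1 ∧ Aᵀ * W * A = !![s₁, 0; 0, s₂] ∧
      Aᵀ * Jt * A = !![0, incompat J Jt; -incompat J Jt, 0] := by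
  set R := invSqrt J
  have hR : Rᵀ = R := by
    have := isHermitian_invSqrt J
    rwa [Matrix.IsHermitian, Matrix.conjTranspose_eq_transpose_of_trivial] at this
  have hWt : Wᵀ = W := by
    rwa [Matrix.IsHermitian, Matrix.conjTranspose_eq_transpose_of_trivial] at hW
  have hK : (R * W * R).IsHermitian := by
    rw [Matrix.IsHermitian, Matrix.conjTranspose_eq_transpose_of_trivial, Matrix.transpose_mul,
      Matrix.transpose_mul, hR, hWt, Matrix.mul_assoc]
  obtain ⟨U, hU, hD⟩ := exists_orthogonal_diagonal hK hs
  have h1 : (R * U)ᵀ * J * (R * U) = 1 := by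
    calc (R * U)ᵀ * J * (R * U) = Uᵀ * (R * J * R) * U := by
          simp only [Matrix.transpose_mul, Matrix.mul_assoc, hR]
      _ = 1 := by rw [invSqrt_mul_mul_invSqrt hJ, Matrix.mul_one, hU]
  have h2 : (R * U)ᵀ * W * (R * U) = !![s₁, 0; 0, s₂] := by
    rw [← hD]
    simp only [Matrix.transpose_mul, Matrix.mul_assoc, hR]
  have hanti : ((R * U)ᵀ * Jt * (R * U))ᵀ = -((R * U)ᵀ * Jt * (R * U)) := by
    simp only [Matrix.transpose_mul, Matrix.transpose_transpose, hJt, Matrix.mul_assoc,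
      Matrix.mul_neg, Matrix.neg_mul]
  set A := R * U
  set b := (Aᵀ * Jt * A) 0 1 with hb
  have h3 : Aᵀ * Jt * A = !![0, b; -b, 0] := by
    have e (i j : Fin 2) : (Aᵀ * Jt * A) j i = -(Aᵀ * Jt * A) i j :=
      congrFun (congrFun hanti i) j
    ext i j
    fin_cases i <;> fin_cases j
    · have := e 0 0
      simp only [Fin.zero_eta, Matrix.of_apply, Matrix.cons_val', Matrix.cons_val_zero]
      linarith
    · rfl
    · exact e 0 1
    · have := e 1 1
      simp only [Fin.mk_one, Matrix.of_apply, Matrix.cons_val', Matrix.cons_val_one,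
        Matrix.cons_val_fin_one]
      linarith
  have hinc := incompat_eq_abs h1 h3
  rcases abs_choice b with hab | hab
  · exact ⟨A, h1, h2, by rw [hinc, hab, h3]⟩
  -- a reflection of one coordinate reverses the orientation
  · have hS (N : Matrix (Fin 2) (Fin 2) ℝ) : (A * !![1, 0; 0, -1])ᵀ * N * (A * !![1, 0; 0, -1])
        = (!![1, 0; 0, -1] : Matrix (Fin 2) (Fin 2) ℝ)ᵀ * (Aᵀ * N * A) * !![1, 0; 0, -1] := by
      simp only [Matrix.transpose_mul, Matrix.mul_assoc]
    refine ⟨A * !![1, 0; 0, -1], ?_, ?_, ?_⟩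
    · rw [hS, h1]; ext i j; fin_cases i <;> fin_cases j <;> simp [Matrix.mul_apply]
    · rw [hS, h2]; ext i j; fin_cases i <;> fin_cases j <;> simp [Matrix.mul_apply]
    · rw [hS, h3, hinc, hab]; ext i j; fin_cases i <;> fin_cases j <;> simp [Matrix.mul_apply]

/-- The weighted Cramér–Rao bound does not depend on the coordinates. -/
lemma trace_mul_inv_eq {W F A : Matrix (Fin 2) (Fin 2) ℝ} (hA : IsUnit A.det) :
    (W * F⁻¹).trace = (Aᵀ * W * A * (Aᵀ * F * A)⁻¹).trace := by
  have hAt : IsUnit Aᵀ.det := by rwa [Matrix.det_transpose]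
  rw [Matrix.mul_inv_rev, Matrix.mul_inv_rev]
  calc (W * F⁻¹).trace = (W * (F⁻¹ * ((Aᵀ)⁻¹ * Aᵀ))).trace := by
        rw [Matrix.nonsing_inv_mul _ hAt, Matrix.mul_one]
    _ = ((W * F⁻¹ * (Aᵀ)⁻¹) * Aᵀ).trace := by simp only [Matrix.mul_assoc]
    _ = (Aᵀ * (W * F⁻¹ * (Aᵀ)⁻¹)).trace := Matrix.trace_mul_comm _ _
    _ = (Aᵀ * W * ((A * A⁻¹) * (F⁻¹ * (Aᵀ)⁻¹))).trace := by
        rw [Matrix.mul_nonsing_inv _ hA, Matrix.one_mul]; simp only [Matrix.mul_assoc]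
    _ = _ := by simp only [Matrix.mul_assoc]

/-- Correlations between the two parameters never help: `(F⁻¹)_jj ≥ 1 / F_jj`. -/
lemma div_add_div_le_trace {F : Matrix (Fin 2) (Fin 2) ℝ} (hF : F.PosSemidef) (hdet : F.det ≠ 0)
    {s₁ s₂ : ℝ} (h₁ : 0 ≤ s₁) (h₂ : 0 ≤ s₂) :
    0 < F 0 0 ∧ 0 < F 1 1 ∧
      s₁ / F 0 0 + s₂ / F 1 1 ≤ (!![s₁, 0; 0, s₂] * F⁻¹).trace := by
  have hd : 0 < F.det := lt_of_le_of_ne hF.det_nonneg hdet.symm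
  have hsym : F 1 0 = F 0 1 := by simpa using hF.isHermitian.apply 0 1
  have h0 : 0 ≤ F 0 0 := hF.diag_nonneg
  have h1 : 0 ≤ F 1 1 := hF.diag_nonneg
  have hdF : F.det = F 0 0 * F 1 1 - F 0 1 ^ 2 := by rw [Matrix.det_fin_two, hsym]; ring
  have hprod : 0 < F 0 0 * F 1 1 := by nlinarith [sq_nonneg (F 0 1)]
  have h0' : 0 < F 0 0 := pos_of_mul_pos_left hprod h1
  have h1' : 0 < F 1 1 := pos_of_mul_pos_right hprod h0
  refine ⟨h0', h1', ?_⟩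
  have htr : (!![s₁, 0; 0, s₂] * F⁻¹).trace = s₁ * (F 1 1 / F.det) + s₂ * (F 0 0 / F.det) := by
    rw [Matrix.inv_def, Ring.inverse_eq_inv', Matrix.adjugate_fin_two]
    simp [Matrix.trace_fin_two]
    ring
  have hle : F.det ≤ F 0 0 * F 1 1 := by nlinarith [sq_nonneg (F 0 1)]
  have a1 : 1 / F 0 0 ≤ F 1 1 / F.det := by rw [div_le_div_iff₀ h0' hd]; linarith
  have a2 : 1 / F 1 1 ≤ F 0 0 / F.det := by rw [div_le_div_iff₀ h1' hd]; linarith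
  rw [htr, div_eq_mul_one_div s₁, div_eq_mul_one_div s₂]
  gcongr

end Normalization

/-! ### From the trade-off to the angle `φ` -/

section Angles

/-- The family of linear inequalities says that the angles `arccos √f₁` and `arccos √f₂` add up to
at least `2 η`, and `φ` distributes the angle `2 η` over the two of them. -/
lemma exists_angle {f₁ f₂ η : ℝ} (hη0 : 0 ≤ η) (hη : η ≤ Real.pi / 4) (h₁0 : 0 ≤ f₁) (h₁ : f₁ ≤ 1)
    (h₂0 : 0 ≤ f₂) (h₂ : f₂ ≤ 1)
    (h : ∀ a b : ℝ, 0 < a → 0 < b → a * b ≤ 1 →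
      2 * Real.sin (2 * η) ≤ a * f₁ + a⁻¹ * (1 - f₂) + b * f₂ + b⁻¹ * (1 - f₁)) :
    ∃ φ ∈ Set.Icc (-η) η, f₁ ≤ Real.cos (φ - η) ^ 2 ∧ f₂ ≤ Real.cos (φ + η) ^ 2 := by
  set α₁ := Real.arccos √f₁ with hα₁
  set α₂ := Real.arccos √f₂ with hα₂
  have hc (f : ℝ) (hf0 : 0 ≤ f) (hf : f ≤ 1) :
      0 ≤ Real.arccos √f ∧ Real.arccos √f ≤ Real.pi / 2 ∧ Real.cos (Real.arccos √f) ^ 2 = f := by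
    refine ⟨Real.arccos_nonneg _, Real.arccos_le_pi_div_two.mpr (Real.sqrt_nonneg f), ?_⟩
    rw [Real.cos_arccos (by linarith [Real.sqrt_nonneg f]) (Real.sqrt_le_one.mpr hf),
      Real.sq_sqrt hf0]
  obtain ⟨hα₁0, hα₁', hcα₁⟩ := hc f₁ h₁0 h₁
  obtain ⟨hα₂0, hα₂', hcα₂⟩ := hc f₂ h₂0 h₂
  rw [← hα₁] at hα₁0 hα₁' hcα₁
  rw [← hα₂] at hα₂0 hα₂' hcα₂
  have hsum : 2 * η ≤ α₁ + α₂ := by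
    by_contra hlt
    push Not at hlt
    -- enlarging the angles slightly makes their sines positive
    set δ := (2 * η - α₁ - α₂) / 4 with hδ
    have hδ0 : 0 < δ := by rw [hδ]; linarith
    set a₁ := α₁ + δ with ha₁
    set a₂ := α₂ + δ with ha₂
    have hlt' : a₁ + a₂ < 2 * η := by rw [ha₁, ha₂]; linarith
    have hp := Real.pi_pos
    have hs₁ : 0 < Real.sin a₁ := Real.sin_pos_of_pos_of_lt_pi (by linarith) (by linarith)
    have hs₂ : 0 < Real.sin a₂ := Real.sin_pos_of_pos_of_lt_pi (by linarith) (by linarith)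
    have hc₁ : 0 < Real.cos a₁ := Real.cos_pos_of_mem_Ioo ⟨by linarith, by linarith⟩
    have hc₂ : 0 < Real.cos a₂ := Real.cos_pos_of_mem_Ioo ⟨by linarith, by linarith⟩
    have hcs : Real.sin a₁ * Real.sin a₂ ≤ Real.cos a₁ * Real.cos a₂ := by
      have : 0 ≤ Real.cos (a₁ + a₂) :=
        Real.cos_nonneg_of_mem_Icc ⟨by linarith, by linarith⟩
      rw [Real.cos_add a₁ a₂] at this
      linarith
    have hf₁ : Real.cos a₁ ^ 2 ≤ f₁ := by
      rw [← hcα₁]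
      exact pow_le_pow_left₀ hc₁.le
        (Real.cos_le_cos_of_nonneg_of_le_pi hα₁0 (by linarith) (by linarith)) 2
    have hf₂ : Real.cos a₂ ^ 2 ≤ f₂ := by
      rw [← hcα₂]
      exact pow_le_pow_left₀ hc₂.le
        (Real.cos_le_cos_of_nonneg_of_le_pi hα₂0 (by linarith) (by linarith)) 2
    -- this choice of `a`, `b` minimizes the right-hand side of `h` at `f_j = cos² a_j`
    have hkey := h (Real.sin a₂ / Real.cos a₁) (Real.sin a₁ / Real.cos a₂)
      (by positivity) (by positivity) (by
        rw [div_mul_div_comm, div_le_one (by positivity)]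
        linarith)
    rw [inv_div, inv_div] at hkey
    have hm₁ : Real.sin a₂ / Real.cos a₁ ≤ Real.cos a₂ / Real.sin a₁ := by
      rw [div_le_div_iff₀ hc₁ hs₁]; linarith
    have hm₂ : Real.sin a₁ / Real.cos a₂ ≤ Real.cos a₁ / Real.sin a₂ := by
      rw [div_le_div_iff₀ hc₂ hs₂]; linarith
    have hval : Real.sin a₂ / Real.cos a₁ * Real.cos a₁ ^ 2
        + Real.cos a₁ / Real.sin a₂ * (1 - Real.cos a₂ ^ 2)
        + Real.sin a₁ / Real.cos a₂ * Real.cos a₂ ^ 2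
        + Real.cos a₂ / Real.sin a₁ * (1 - Real.cos a₁ ^ 2) = 2 * Real.sin (a₁ + a₂) := by
      rw [← Real.sin_sq, ← Real.sin_sq, Real.sin_add a₁ a₂]
      field_simp
      ring
    have hstrict : Real.sin (a₁ + a₂) < Real.sin (2 * η) :=
      Real.sin_lt_sin_of_lt_of_le_pi_div_two (by linarith) (by linarith) hlt'
    nlinarith [mul_nonneg (sub_nonneg.mpr hm₁) (sub_nonneg.mpr hf₁),
      mul_nonneg (sub_nonneg.mpr hm₂) (sub_nonneg.mpr hf₂)]
  -- any `φ` with `η - φ ≤ α₁` and `η + φ ≤ α₂` will do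
  refine ⟨max (η - α₁) (-η), ⟨le_max_right _ _, max_le (by linarith) (by linarith)⟩, ?_, ?_⟩
  · rw [← hcα₁, ← neg_sub η, Real.cos_neg]
    have hub : η - max (η - α₁) (-η) ≤ α₁ := by linarith [le_max_left (η - α₁) (-η)]
    have hlb : 0 ≤ η - max (η - α₁) (-η) := by
      have : max (η - α₁) (-η) ≤ η := max_le (by linarith) (by linarith)
      linarith
    exact pow_le_pow_left₀ (Real.cos_nonneg_of_mem_Icc ⟨by linarith, by linarith⟩)
      (Real.cos_le_cos_of_nonneg_of_le_pi hlb (by linarith) hub) 2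
  · rw [← hcα₂]
    have hub : max (η - α₁) (-η) + η ≤ α₂ := by
      have : max (η - α₁) (-η) ≤ α₂ - η := max_le (by linarith) (by linarith)
      linarith
    have hlb : 0 ≤ max (η - α₁) (-η) + η := by linarith [le_max_right (η - α₁) (-η)]
    exact pow_le_pow_left₀ (Real.cos_nonneg_of_mem_Icc ⟨by linarith, by linarith⟩)
      (Real.cos_le_cos_of_nonneg_of_le_pi hlb (by linarith) hub) 2

lemma objective_le {s₁ s₂ η φ f₁ f₂ : ℝ} (hs₁ : 0 ≤ s₁) (hs₂ : 0 ≤ s₂) (hf₁ : 0 < f₁)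
    (hf₂ : 0 < f₂) (h₁ : f₁ ≤ Real.cos (φ - η) ^ 2) (h₂ : f₂ ≤ Real.cos (φ + η) ^ 2) :
    objective s₁ s₂ η φ ≤ ENNReal.ofReal (s₁ / f₁ + s₂ / f₂) := by
  rw [ENNReal.ofReal_add (by positivity) (by positivity), ENNReal.ofReal_div_of_pos hf₁,
    ENNReal.ofReal_div_of_pos hf₂, objective]
  gcongr

lemma objective_eq_ofReal {s₁ s₂ η φ : ℝ} (hs₁ : 0 ≤ s₁) (hs₂ : 0 ≤ s₂)
    (h₁ : Real.cos (φ - η) ≠ 0) (h₂ : Real.cos (φ + η) ≠ 0) :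
    objective s₁ s₂ η φ
      = ENNReal.ofReal (s₁ / Real.cos (φ - η) ^ 2 + s₂ / Real.cos (φ + η) ^ 2) := by
  rw [ENNReal.ofReal_add (by positivity) (by positivity), ENNReal.ofReal_div_of_pos (by positivity),
    ENNReal.ofReal_div_of_pos (by positivity), objective]

lemma continuous_objective (s₁ s₂ η : ℝ) : Continuous (objective s₁ s₂ η) := by
  have hc {f : ℝ → ℝ} (hf : Continuous f) (s : ℝ) :
      Continuous fun φ => ENNReal.ofReal s / ENNReal.ofReal (f φ) := by
    simp only [div_eq_mul_inv]
    exact (ENNReal.continuous_const_mul ENNReal.ofReal_ne_top).comp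
      (continuous_inv.comp (ENNReal.continuous_ofReal.comp hf))
  exact (hc (by fun_prop) s₁).add (hc (by fun_prop) s₂)

end Angles

/-! ### Stationarity of the minimizers -/

section Minimizers

lemma cos_ne_zero_of_objective_ne_top {s₁ s₂ η φ : ℝ} (h : objective s₁ s₂ η φ ≠ ⊤) :
    (0 < s₁ → Real.cos (φ - η) ≠ 0) ∧ (0 < s₂ → Real.cos (φ + η) ≠ 0) := by
  constructor
  · intro hs hc
    apply h
    rw [objective, hc]
    simp [ENNReal.div_zero, hs]
  · intro hs hc
    apply h
    rw [objective, hc]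
    simp [ENNReal.div_zero, hs]

/-- The derivative of the objective, where its denominators do not vanish. -/
lemma hasDerivAt_objective_real (s₁ s₂ η φ : ℝ) (h₁ : Real.cos (φ - η) ≠ 0)
    (h₂ : Real.cos (φ + η) ≠ 0) :
    HasDerivAt (fun t => s₁ / Real.cos (t - η) ^ 2 + s₂ / Real.cos (t + η) ^ 2)
      (2 * s₁ * Real.sin (φ - η) / Real.cos (φ - η) ^ 3
        + 2 * s₂ * Real.sin (φ + η) / Real.cos (φ + η) ^ 3) φ := by
  have e₁ : HasDerivAt (fun t => Real.cos (t - η)) (-Real.sin (φ - η) * 1) φ :=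
    ((hasDerivAt_id φ).sub_const η).cos
  have e₂ : HasDerivAt (fun t => Real.cos (t + η)) (-Real.sin (φ + η) * 1) φ :=
    ((hasDerivAt_id φ).add_const η).cos
  refine (((hasDerivAt_const φ s₁).div (e₁.pow 2) (pow_ne_zero 2 h₁)).add
    ((hasDerivAt_const φ s₂).div (e₂.pow 2) (pow_ne_zero 2 h₂))).congr_deriv ?_
  simp only [Pi.pow_apply]
  field_simp
  ring

lemma objective_neg (s₁ s₂ η φ : ℝ) : objective s₁ s₂ η (-φ) = objective s₂ s₁ η φ := by
  rw [objective, objective, add_comm, show -φ + η = -(φ - η) by ring,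
    show -φ - η = -(φ + η) by ring, Real.cos_neg, Real.cos_neg]

/-- At the right end point `φ = η` the first term is already minimal and the second one still
grows, so that a minimum there forces `s₂ = 0`. -/
lemma eq_zero_of_isMinOn_right {s₁ s₂ η : ℝ} (hs₁ : 0 ≤ s₁) (hs₂ : 0 ≤ s₂) (hη0 : 0 < η)
    (hη : η ≤ Real.pi / 4) (hmin : ∀ t ∈ Set.Icc (-η) η, objective s₁ s₂ η η ≤ objective s₁ s₂ η t)
    (htop : objective s₁ s₂ η η ≠ ⊤) : s₂ = 0 := by
  by_contra hne
  have hpos : 0 < s₂ := lt_of_le_of_ne hs₂ (Ne.symm hne)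
  have hc₂ := (cos_ne_zero_of_objective_ne_top htop).2 hpos
  have hc₁ : Real.cos (η - η) ≠ 0 := by simp
  have hp := Real.pi_pos
  have hd := hasDerivAt_objective_real s₁ s₂ η η hc₁ hc₂
  have hcpos : 0 < Real.cos (η + η) :=
    lt_of_le_of_ne (Real.cos_nonneg_of_mem_Icc ⟨by linarith, by linarith⟩) hc₂.symm
  have hspos : 0 < Real.sin (η + η) := Real.sin_pos_of_pos_of_lt_pi (by linarith) (by linarith)
  have hpos' : 0 < 2 * s₁ * Real.sin (η - η) / Real.cos (η - η) ^ 3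
      + 2 * s₂ * Real.sin (η + η) / Real.cos (η + η) ^ 3 := by
    rw [sub_self, Real.sin_zero, mul_zero, zero_div, zero_add]; positivity
  have hev := (hasDerivAt_iff_tendsto_slope.mp hd).eventually (lt_mem_nhds hpos')
  have hev' : ∀ᶠ t in nhdsWithin η (Set.Iio η), 0 < slope
      (fun t => s₁ / Real.cos (t - η) ^ 2 + s₂ / Real.cos (t + η) ^ 2) η t :=
    hev.filter_mono (nhdsWithin_mono _ fun t (ht : t < η) => ht.ne)
  have hin : ∀ᶠ t in nhdsWithin η (Set.Iio η), t ∈ Set.Ioo (-η) η :=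
    Ioo_mem_nhdsLT (by linarith)
  obtain ⟨t, ht1, ht2⟩ := (hev'.and hin).exists
  have hct₁ : 0 < Real.cos (t - η) :=
    Real.cos_pos_of_mem_Ioo ⟨by linarith [ht2.1], by linarith [ht2.2]⟩
  have hct₂ : 0 < Real.cos (t + η) :=
    Real.cos_pos_of_mem_Ioo ⟨by linarith [ht2.1], by linarith [ht2.2]⟩
  have hle := hmin t ⟨ht2.1.le, ht2.2.le⟩
  rw [objective_eq_ofReal hs₁ hs₂ hc₁ hc₂, objective_eq_ofReal hs₁ hs₂ hct₁.ne' hct₂.ne',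
    ENNReal.ofReal_le_ofReal_iff (by positivity)] at hle
  rw [slope_def_field] at ht1
  exact absurd ht1 (not_lt.mpr (div_nonpos_of_nonneg_of_nonpos (sub_nonneg.mpr hle)
    (by linarith [ht2.2])))

lemma quartic_neg (s₁ s₂ η x : ℝ) : quartic s₁ s₂ η (-x) = -quartic s₂ s₁ η x := by
  rw [quartic, quartic]; ring

/-- The quartic, up to the factor `2`, is the stationarity condition cleared of denominators. -/
lemma quartic_eq (s₁ s₂ η x : ℝ) :
    quartic s₁ s₂ η x
      = 2 * (s₁ * (x * Real.cos η - Real.sin η) * (Real.cos η - x * Real.sin η) ^ 3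
        + s₂ * (x * Real.cos η + Real.sin η) * (Real.cos η + x * Real.sin η) ^ 3) := by
  rw [quartic]; ring

lemma quartic_tan_right {s₁ η : ℝ} (hη : Real.cos η ≠ 0) : quartic s₁ 0 η (Real.tan η) = 0 := by
  rw [quartic_eq, Real.tan_mul_cos hη]; ring

/-- Every minimizer is stationary, or lies at an end point where the moving term is absent. -/
lemma quartic_eq_zero_of_isMinOn {s₁ s₂ η φ : ℝ} (hs₁ : 0 ≤ s₁) (hs₂ : 0 ≤ s₂)
    (hη0 : 0 ≤ η) (hη : η ≤ Real.pi / 4) (hφ : φ ∈ Set.Icc (-η) η)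
    (hmin : ∀ t ∈ Set.Icc (-η) η, objective s₁ s₂ η φ ≤ objective s₁ s₂ η t)
    (htop : objective s₁ s₂ η φ ≠ ⊤) : quartic s₁ s₂ η (Real.tan φ) = 0 := by
  have hp := Real.pi_pos
  have hcη : Real.cos η ≠ 0 := (Real.cos_pos_of_mem_Ioo ⟨by linarith, by linarith⟩).ne'
  -- for `η = 0` the interval is a single point, where no derivative is available
  rcases hη0.eq_or_lt with h0 | h0
  · subst h0
    have : φ = 0 := by have h1 := hφ.1; have h2 := hφ.2; linarith
    subst this
    simp [quartic]
  rcases hφ.2.eq_or_lt with hr | hr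
  · subst hr
    rw [eq_zero_of_isMinOn_right hs₁ hs₂ h0 hη hmin htop, quartic_tan_right hcη]
  rcases hφ.1.eq_or_lt with hl | hl
  · subst hl
    have hmin' : ∀ t ∈ Set.Icc (-η) η, objective s₂ s₁ η η ≤ objective s₂ s₁ η t := by
      intro t ht
      have := hmin (-t) ⟨by linarith [ht.2], by linarith [ht.1]⟩
      rwa [objective_neg, objective_neg] at this
    rw [objective_neg] at htop
    rw [eq_zero_of_isMinOn_right hs₂ hs₁ h0 hη hmin' htop, Real.tan_neg, quartic_neg,
      quartic_tan_right hcη, neg_zero]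
  have hc (t : ℝ) (ht : t ∈ Set.Ioo (-η) η) :
      0 < Real.cos (t - η) ∧ 0 < Real.cos (t + η) :=
    ⟨Real.cos_pos_of_mem_Ioo ⟨by linarith [ht.1], by linarith [ht.2]⟩,
      Real.cos_pos_of_mem_Ioo ⟨by linarith [ht.1], by linarith [ht.2]⟩⟩
  obtain ⟨hc₁, hc₂⟩ := hc φ ⟨hl, hr⟩
  have hloc : IsLocalMin (fun t => s₁ / Real.cos (t - η) ^ 2 + s₂ / Real.cos (t + η) ^ 2) φ := by
    filter_upwards [Ioo_mem_nhds hl hr] with t ht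
    obtain ⟨ht₁, ht₂⟩ := hc t ht
    have hle := hmin t ⟨ht.1.le, ht.2.le⟩
    rwa [objective_eq_ofReal hs₁ hs₂ hc₁.ne' hc₂.ne', objective_eq_ofReal hs₁ hs₂ ht₁.ne' ht₂.ne',
      ENNReal.ofReal_le_ofReal_iff (by positivity)] at hle
  have hz := hloc.hasDerivAt_eq_zero (hasDerivAt_objective_real s₁ s₂ η φ hc₁.ne' hc₂.ne')
  have hcφ : Real.cos φ ≠ 0 := (Real.cos_pos_of_mem_Ioo ⟨by linarith, by linarith⟩).ne'
  have hz' : s₁ * Real.sin (φ - η) * Real.cos (φ + η) ^ 3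
      + s₂ * Real.sin (φ + η) * Real.cos (φ - η) ^ 3 = 0 := by
    have h1 := hc₁.ne'
    have h2 := hc₂.ne'
    field_simp at hz
    linarith
  rw [Real.sin_sub, Real.sin_add, Real.cos_sub, Real.cos_add] at hz'
  have hsin : Real.sin φ = Real.tan φ * Real.cos φ := (Real.tan_mul_cos hcφ).symm
  rw [hsin] at hz'
  have hq : Real.cos φ ^ 4 * quartic s₁ s₂ η (Real.tan φ) = 0 := by
    rw [quartic_eq]
    linear_combination 2 * hz'
  exact (mul_eq_zero.mp hq).resolve_left (pow_ne_zero 4 hcφ)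

lemma abs_tan_le {η φ : ℝ} (hη : η < Real.pi / 2) (hφ : φ ∈ Set.Icc (-η) η) :
    |Real.tan φ| ≤ Real.tan η := by
  have hη' : η ∈ Set.Ioo (-(Real.pi / 2)) (Real.pi / 2) := ⟨by linarith [hφ.1, hφ.2], hη⟩
  have hφ' : φ ∈ Set.Ioo (-(Real.pi / 2)) (Real.pi / 2) :=
    ⟨by linarith [hφ.1], by linarith [hφ.2]⟩
  have hn : -η ∈ Set.Ioo (-(Real.pi / 2)) (Real.pi / 2) := ⟨by linarith, by linarith [hη'.1]⟩
  rw [abs_le, ← Real.tan_neg]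
  exact ⟨Real.strictMonoOn_tan.monotoneOn hn hφ' hφ.1,
    Real.strictMonoOn_tan.monotoneOn hφ' hη' hφ.2⟩

end Minimizers

/-! ### Optimal measurements -/

section Construction

/-- A rational orthogonal matrix none of whose entries vanish. -/
def rot : Matrix (Fin 3) (Fin 3) ℝ :=
  !![1 / 3, 2 / 3, 2 / 3; 2 / 3, 1 / 3, -2 / 3; 2 / 3, -2 / 3, 1 / 3]

/-- The vectors of the optimal measurement: the frame `v, g₁, g₂` turned by `rot`, so that every one
of them overlaps with the state `v`. -/
def frame (v g₁ g₂ : H) (i : Fin 3) : H :=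
  (rot i 0 : ℂ) • v + (rot i 1 : ℂ) • g₁ + (rot i 2 : ℂ) • g₂

lemma inner_frame (v g₁ g₂ x : H) (i : Fin 3) :
    ⟪frame v g₁ g₂ i, x⟫_ℂ = rot i 0 * ⟪v, x⟫_ℂ + rot i 1 * ⟪g₁, x⟫_ℂ + rot i 2 * ⟪g₂, x⟫_ℂ := by
  simp only [frame, inner_add_left, inner_smul_left, Complex.conj_ofReal]

lemma sum_normSq_inner_frame (v g₁ g₂ x : H) :
    ∑ i, Complex.normSq ⟪frame v g₁ g₂ i, x⟫_ℂ
      = Complex.normSq ⟪v, x⟫_ℂ + Complex.normSq ⟪g₁, x⟫_ℂ + Complex.normSq ⟪g₂, x⟫_ℂ := by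
  simp only [inner_frame, Fin.sum_univ_three, Complex.normSq_apply, Complex.add_re, Complex.add_im,
    Complex.re_ofReal_mul, Complex.im_ofReal_mul]
  simp [rot]
  ring

lemma re_inner_rankOne_self (b x : H) :
    (⟪InnerProductSpace.rankOne ℂ b b x, x⟫_ℂ).re = Complex.normSq ⟪b, x⟫_ℂ := by
  rw [InnerProductSpace.rankOne_apply, inner_smul_left, ← Complex.normSq_eq_conj_mul_self,
    Complex.ofReal_re]

/-- The measurement along the vectors of `frame`, completed by one more outcome. -/
def framePOVM (v g₁ g₂ : H)
    (hB : ∀ x : H, Complex.normSq ⟪v, x⟫_ℂ + Complex.normSq ⟪g₁, x⟫_ℂ + Complex.normSq ⟪g₂, x⟫_ℂ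
      ≤ (⟪x, x⟫_ℂ).re) : POVM (Option (Fin 3)) H where
  effect
    | none => 1 - ∑ i, InnerProductSpace.rankOne ℂ (frame v g₁ g₂ i) (frame v g₁ g₂ i)
    | some i => InnerProductSpace.rankOne ℂ (frame v g₁ g₂ i) (frame v g₁ g₂ i)
  pos
    | none => by
      refine ⟨?_, fun x => ?_⟩
      · exact ContinuousLinearMap.isPositive_one.isSymmetric.sub
          (ContinuousLinearMap.isPositive_sum (E := H) Finset.univ fun i _ =>
            InnerProductSpace.isPositive_rankOne_self (𝕜 := ℂ) (frame v g₁ g₂ i)).isSymmetric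
      · have h := hB x
        rw [← sum_normSq_inner_frame] at h
        simp only [← re_inner_rankOne_self] at h
        simp only [ContinuousLinearMap.reApplyInnerSelf_apply, _root_.sub_apply,
          one_apply_eq_self, _root_.sum_apply, inner_sub_left, sum_inner,
          map_sub, map_sum]
        exact sub_nonneg.mpr h
    | some i => InnerProductSpace.isPositive_rankOne_self (frame v g₁ g₂ i)
  sum_eq x := by
    have h := hasSum_fintype (fun o : Option (Fin 3) => (match o with
      | none => 1 - ∑ i, InnerProductSpace.rankOne ℂ (frame v g₁ g₂ i) (frame v g₁ g₂ i)
      | some i => InnerProductSpace.rankOne ℂ (frame v g₁ g₂ i) (frame v g₁ g₂ i) : H →L[ℂ] H) x)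
    rw [Fintype.sum_option] at h
    simpa using h

lemma fisherForm_framePOVM {v g₁ g₂ : H}
    (hB : ∀ x : H, Complex.normSq ⟪v, x⟫_ℂ + Complex.normSq ⟪g₁, x⟫_ℂ + Complex.normSq ⟪g₂, x⟫_ℂ
      ≤ (⟪x, x⟫_ℂ).re) (hv : ‖v‖ = 1) (hg₁ : ⟪v, g₁⟫_ℂ = 0) (hg₂ : ⟪v, g₂⟫_ℂ = 0) {x y : H}
    (hx : ⟪v, x⟫_ℂ = 0) (hy : ⟪v, y⟫_ℂ = 0) :
    fisherForm (framePOVM v g₁ g₂ hB) v x y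
      = (⟪g₁, x⟫_ℂ).re * (⟪g₁, y⟫_ℂ).re + (⟪g₂, x⟫_ℂ).re * (⟪g₂, y⟫_ℂ).re := by
  have hvv : ⟪v, v⟫_ℂ = 1 := by rw [inner_self_eq_norm_sq_to_K, hv]; simp
  have hg₁' : ⟪g₁, v⟫_ℂ = 0 := inner_eq_zero_symm.mp hg₁
  have hg₂' : ⟪g₂, v⟫_ℂ = 0 := inner_eq_zero_symm.mp hg₂
  have hvf (i : Fin 3) : ⟪v, frame v g₁ g₂ i⟫_ℂ = rot i 0 := by
    simp only [frame, inner_add_right, inner_smul_right, hvv, hg₁, hg₂, mul_one, mul_zero, add_zero]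
  have hfv (i : Fin 3) : ⟪frame v g₁ g₂ i, v⟫_ℂ = rot i 0 := by
    simp only [inner_frame, hvv, hg₁', hg₂', mul_one, mul_zero, add_zero]
  -- the additional outcome has probability zero in the state `v`
  have hnone : (⟪v, (framePOVM v g₁ g₂ hB).effect none v⟫_ℂ).re = 0 := by
    have h : (framePOVM v g₁ g₂ hB).effect none v
        = v - ∑ i, ⟪frame v g₁ g₂ i, v⟫_ℂ • frame v g₁ g₂ i := by
      simp [framePOVM]
    rw [h, inner_sub_right, inner_sum]
    simp only [inner_smul_right, hvf, hfv, hvv, ← Complex.ofReal_mul, Complex.sub_re,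
      Fin.sum_univ_three]
    simp [rot]
    norm_num
  have hsome (i : Fin 3) (z : H) : (⟪v, (framePOVM v g₁ g₂ hB).effect (some i) z⟫_ℂ).re
      = rot i 0 * (rot i 0 * (⟪v, z⟫_ℂ).re + rot i 1 * (⟪g₁, z⟫_ℂ).re
        + rot i 2 * (⟪g₂, z⟫_ℂ).re) := by
    have h : (framePOVM v g₁ g₂ hB).effect (some i) z
        = ⟪frame v g₁ g₂ i, z⟫_ℂ • frame v g₁ g₂ i := rfl
    rw [h, inner_smul_right, hvf, mul_comm, Complex.re_ofReal_mul, inner_frame]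
    simp only [Complex.add_re, Complex.re_ofReal_mul]
  rw [fisherForm, tsum_fintype, Fintype.sum_option, hnone, div_zero, zero_add,
    Fin.sum_univ_three]
  simp only [hsome, hx, hy, hvv, hg₁', hg₂']
  simp [rot]
  ring

/-- Bessel's inequality for `g₁, g₂` extends to the frame `v, g₁, g₂`. -/
lemma bessel_frame {v g₁ g₂ : H} (hv : ‖v‖ = 1) (hg₁ : ⟪v, g₁⟫_ℂ = 0) (hg₂ : ⟪v, g₂⟫_ℂ = 0)
    (hB : ∀ x : H, Complex.normSq ⟪g₁, x⟫_ℂ + Complex.normSq ⟪g₂, x⟫_ℂ ≤ (⟪x, x⟫_ℂ).re) (x : H) :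
    Complex.normSq ⟪v, x⟫_ℂ + Complex.normSq ⟪g₁, x⟫_ℂ + Complex.normSq ⟪g₂, x⟫_ℂ
      ≤ (⟪x, x⟫_ℂ).re := by
  have hvv : ⟪v, v⟫_ℂ = 1 := by rw [inner_self_eq_norm_sq_to_K, hv]; simp
  have hg₁' : ⟪g₁, v⟫_ℂ = 0 := inner_eq_zero_symm.mp hg₁
  have hg₂' : ⟪g₂, v⟫_ℂ = 0 := inner_eq_zero_symm.mp hg₂
  have h := hB (x - ⟪v, x⟫_ℂ • v)
  have e : ⟪x - ⟪v, x⟫_ℂ • v, x - ⟪v, x⟫_ℂ • v⟫_ℂ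
      = ⟪x, x⟫_ℂ - (Complex.normSq ⟪v, x⟫_ℂ : ℂ) := by
    have hxv : ⟪x, v⟫_ℂ = (starRingEnd ℂ) ⟪v, x⟫_ℂ := (inner_conj_symm _ _).symm
    simp only [inner_sub_left, inner_sub_right, inner_smul_left, inner_smul_right, hvv, hxv,
      Complex.normSq_eq_conj_mul_self]
    ring
  rw [e, Complex.sub_re, Complex.ofReal_re] at h
  simp only [inner_sub_right, inner_smul_right, hg₁', hg₂', mul_zero, sub_zero] at h
  linarith

/-- Vectors realizing a given distribution `α₁ + α₂` of the angle `arcsin β`. For `β < 1` the score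
vectors are `e₁ = cos α₁ g₁ - i sin α₁ g₂` and `e₂ = cos α₂ g₂ + i sin α₂ g₁` with an orthonormal
pair `g₁, g₂`, found by solving these equations, whose determinant is `cos (α₁ + α₂)`. For `β = 1`
the score vectors are complex multiples of each other, and the multiples `g_j = cos α_j e_j`
correspond to a randomized choice between measuring one and the other. -/
lemma exists_measurement_vectors {e₁ e₂ : H} {β α₁ α₂ : ℝ} (he₁ : ⟪e₁, e₁⟫_ℂ = 1)
    (he₂ : ⟪e₂, e₂⟫_ℂ = 1) (he : ⟪e₁, e₂⟫_ℂ = β * Complex.I) (hsin : Real.sin (α₁ + α₂) = β) :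
    ∃ g₁ g₂ : H, (∀ v : H, ⟪v, e₁⟫_ℂ = 0 → ⟪v, e₂⟫_ℂ = 0 → ⟪v, g₁⟫_ℂ = 0 ∧ ⟪v, g₂⟫_ℂ = 0) ∧
      (∀ x : H, Complex.normSq ⟪g₁, x⟫_ℂ + Complex.normSq ⟪g₂, x⟫_ℂ ≤ (⟪x, x⟫_ℂ).re) ∧
      (⟪g₁, e₁⟫_ℂ).re = Real.cos α₁ ∧ (⟪g₁, e₂⟫_ℂ).re = 0 ∧
      (⟪g₂, e₁⟫_ℂ).re = 0 ∧ (⟪g₂, e₂⟫_ℂ).re = Real.cos α₂ := by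
  have he' : ⟪e₂, e₁⟫_ℂ = -(β * Complex.I) := by
    rw [← inner_conj_symm, he, map_mul, Complex.conj_ofReal, Complex.conj_I, mul_neg]
  by_cases hC : Real.cos (α₁ + α₂) = 0
  · have hs2 : Real.sin (α₁ + α₂) ^ 2 = 1 := by
      have := Real.sin_sq_add_cos_sq (α₁ + α₂)
      rw [hC] at this; linarith
    have hcc : Real.cos α₁ ^ 2 + Real.cos α₂ ^ 2 = 1 := by
      -- `α₂` is a right angle minus `α₁`, up to multiples of `π`
      have h1 : Real.cos α₂ = Real.sin (α₁ + α₂) * Real.sin α₁ := by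
        have : Real.cos α₂ = Real.cos (α₁ + α₂ - α₁) := by ring_nf
        rw [this, Real.cos_sub, hC, zero_mul, zero_add]
      rw [h1, mul_pow, hs2, one_mul, add_comm]
      exact Real.sin_sq_add_cos_sq α₁
    refine ⟨(Real.cos α₁ : ℂ) • e₁, (Real.cos α₂ : ℂ) • e₂, ?_, ?_, ?_, ?_, ?_, ?_⟩
    · intro v h1 h2
      simp only [inner_smul_right, h1, h2, mul_zero, and_self]
    · intro x
      have hcs (e : H) (h : ⟪e, e⟫_ℂ = 1) : Complex.normSq ⟪e, x⟫_ℂ ≤ (⟪x, x⟫_ℂ).re := by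
        have := cauchySchwarz (E := 1) ContinuousLinearMap.isPositive_one e x
        simp only [one_apply_eq_self, h, Complex.one_re, one_mul] at this
        rw [Complex.normSq_apply]
        linarith
      simp only [inner_smul_left, Complex.conj_ofReal, Complex.normSq_mul, Complex.normSq_ofReal]
      have h1 := mul_le_mul_of_nonneg_left (hcs e₁ he₁) (sq_nonneg (Real.cos α₁))
      have h2 := mul_le_mul_of_nonneg_left (hcs e₂ he₂) (sq_nonneg (Real.cos α₂))
      have h3 : (⟪x, x⟫_ℂ).re = (Real.cos α₁ ^ 2 + Real.cos α₂ ^ 2) * (⟪x, x⟫_ℂ).re := by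
        rw [hcc, one_mul]
      linarith
    all_goals
      simp only [inner_smul_left, Complex.conj_ofReal, he₁, he₂, he, he', Complex.re_ofReal_mul]
      simp
  · have hC' : (Real.cos (α₁ + α₂) : ℂ) ≠ 0 := by exact_mod_cast hC
    set C := Real.cos (α₁ + α₂)
    have hCexp : C = Real.cos α₁ * Real.cos α₂ - Real.sin α₁ * Real.sin α₂ := Real.cos_add _ _
    have hβ : β = Real.sin α₁ * Real.cos α₂ + Real.cos α₁ * Real.sin α₂ := by
      rw [← hsin, Real.sin_add]
    have t₁ := Real.sin_sq_add_cos_sq α₁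
    have t₂ := Real.sin_sq_add_cos_sq α₂
    set c₁ := Real.cos α₁
    set c₂ := Real.cos α₂
    set S₁ := Real.sin α₁
    set S₂ := Real.sin α₂
    set g₁ := (C : ℂ)⁻¹ • ((c₂ : ℂ) • e₁ + (Complex.I * S₁) • e₂) with hg₁
    set g₂ := (C : ℂ)⁻¹ • ((c₁ : ℂ) • e₂ - (Complex.I * S₂) • e₁) with hg₂
    have k₁ : c₂ - S₁ * β = C * c₁ := by rw [hβ, hCexp]; linear_combination -c₂ * t₁
    have k₂ : c₁ - S₂ * β = C * c₂ := by rw [hβ, hCexp]; linear_combination -c₁ * t₂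
    have k₃ : c₂ * β - S₁ = C * S₂ := by rw [hβ, hCexp]; linear_combination S₁ * t₂
    have k₄ : c₁ * β - S₂ = C * S₁ := by rw [hβ, hCexp]; linear_combination S₂ * t₁
    have k₁' : (c₂ : ℂ) - S₁ * β = C * c₁ := by exact_mod_cast k₁
    have k₂' : (c₁ : ℂ) - S₂ * β = C * c₂ := by exact_mod_cast k₂
    have k₃' : (c₂ : ℂ) * β - S₁ = C * S₂ := by exact_mod_cast k₃
    have k₄' : (c₁ : ℂ) * β - S₂ = C * S₁ := by exact_mod_cast k₄
    have i11 : ⟪g₁, e₁⟫_ℂ = c₁ := by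
      simp only [hg₁, inner_smul_left, inner_add_left, he₁, he', map_inv₀, Complex.conj_ofReal,
        map_mul, Complex.conj_I]
      field_simp
      linear_combination k₁' + (S₁ * β : ℂ) * Complex.I_sq
    have i12 : ⟪g₁, e₂⟫_ℂ = S₂ * Complex.I := by
      simp only [hg₁, inner_smul_left, inner_add_left, he₂, he, map_inv₀, Complex.conj_ofReal,
        map_mul, Complex.conj_I]
      field_simp
      linear_combination k₃'
    have i21 : ⟪g₂, e₁⟫_ℂ = -(S₁ * Complex.I) := by
      simp only [hg₂, inner_smul_left, inner_sub_left, he₁, he', map_inv₀, Complex.conj_ofReal,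
        map_mul, Complex.conj_I]
      field_simp
      linear_combination -k₄'
    have i22 : ⟪g₂, e₂⟫_ℂ = c₂ := by
      simp only [hg₂, inner_smul_left, inner_sub_left, he₂, he, map_inv₀, Complex.conj_ofReal,
        map_mul, Complex.conj_I]
      field_simp
      linear_combination k₂' + (S₂ * β : ℂ) * Complex.I_sq
    have hCexp' : (C : ℂ) = c₁ * c₂ - S₁ * S₂ := by exact_mod_cast hCexp
    have x₁ (x : H) : ⟪x, g₁⟫_ℂ = (C : ℂ)⁻¹ * (c₂ * ⟪x, e₁⟫_ℂ + Complex.I * S₁ * ⟪x, e₂⟫_ℂ) := by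
      simp only [hg₁, inner_smul_right, inner_add_right]
    have x₂ (x : H) : ⟪x, g₂⟫_ℂ = (C : ℂ)⁻¹ * (c₁ * ⟪x, e₂⟫_ℂ - Complex.I * S₂ * ⟪x, e₁⟫_ℂ) := by
      simp only [hg₂, inner_smul_right, inner_sub_right]
    have o11 : ⟪g₁, g₁⟫_ℂ = 1 := by
      rw [x₁, i11, i12, inv_mul_eq_one₀ hC']
      linear_combination hCexp' - (S₁ * S₂ : ℂ) * Complex.I_sq
    have o22 : ⟪g₂, g₂⟫_ℂ = 1 := by
      rw [x₂, i21, i22, inv_mul_eq_one₀ hC']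
      linear_combination hCexp' - (S₁ * S₂ : ℂ) * Complex.I_sq
    have o12 : ⟪g₁, g₂⟫_ℂ = 0 := by
      rw [x₂, i11, i12]
      ring
    refine ⟨g₁, g₂, ?_, ?_, ?_, ?_, ?_, ?_⟩
    · intro v h1 h2
      simp only [x₁, x₂, h1, h2, mul_zero, add_zero, sub_zero, and_self]
    · intro x
      have hON : Orthonormal ℂ ![g₁, g₂] := by
        rw [orthonormal_iff_ite]
        intro i j
        have o21 : ⟪g₂, g₁⟫_ℂ = 0 := inner_eq_zero_symm.mp o12
        fin_cases i <;> fin_cases j <;> simp [-inner_self_eq_norm_sq_to_K, o11, o12, o21, o22]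
      have h := hON.sum_inner_products_le x (s := Finset.univ)
      simp only [Fin.sum_univ_two, Matrix.cons_val_zero, Matrix.cons_val_one] at h
      rw [Complex.normSq_eq_norm_sq, Complex.normSq_eq_norm_sq, inner_self_eq_norm_sq_to_K]
      norm_cast at h ⊢
    · rw [i11, Complex.ofReal_re]
    · rw [i12]; simp
    · rw [i21]; simp
    · rw [i22, Complex.ofReal_re]

end Construction

/-! ### The classical Cramér–Rao inequality -/

section ClassicalCramerRao

variable {ι : Type} {p : ι → ℝ} {d : Fin 2 → ι → ℝ}

/-- Outcome probabilities `p` and their derivatives `d` in two parameters, with finite Fisher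
information. The derivatives vanish where `p` does, so that the value `0` of `d / 0` is the right
one for the scores and the Fisher information. -/
structure IsRegular (p : ι → ℝ) (d : Fin 2 → ι → ℝ) : Prop where
  nonneg : ∀ i, 0 ≤ p i
  hasSum : HasSum p 1
  hasSum_deriv : ∀ j, HasSum (d j) 0
  deriv_eq_zero : ∀ j i, p i = 0 → d j i = 0
  summable : ∀ j k, Summable fun i => d j i * d k i / p i

/-- The classical Fisher information matrix. -/
def fisherMatrix (p : ι → ℝ) (d : Fin 2 → ι → ℝ) : Matrix (Fin 2) (Fin 2) ℝ :=
  Matrix.of fun j k => ∑' i, d j i * d k i / p i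

/-- The second moments of the deviation of an estimator `T` from `θ`. -/
def mseMatrix (p : ι → ℝ) (θ : Fin 2 → ℝ) (T : ι → Fin 2 → ℝ) : Matrix (Fin 2) (Fin 2) ℝ :=
  Matrix.of fun j k => ∑' i, p i * ((T i j - θ j) * (T i k - θ k))

lemma hasSum_of_eq {f g : ι → ℝ} {a b : ℝ} (h : HasSum f a) (hfg : ∀ i, g i = f i) (hab : b = a) :
    HasSum g b := by
  rw [hab, funext hfg]; exact h

namespace IsRegular

lemma hasSum_fisher (h : IsRegular p d) (j k : Fin 2) :
    HasSum (fun i => d j i * d k i / p i) (fisherMatrix p d j k) :=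
  (h.summable j k).hasSum

lemma fisherMatrix_symm (p : ι → ℝ) (d : Fin 2 → ι → ℝ) (j k : Fin 2) :
    fisherMatrix p d j k = fisherMatrix p d k j := by
  simp only [fisherMatrix, Matrix.of_apply, mul_comm]

lemma hasSum_quadratic (h : IsRegular p d) (u : Fin 2 → ℝ) :
    HasSum (fun i => (∑ j, u j * d j i) ^ 2 / p i) (u ⬝ᵥ fisherMatrix p d *ᵥ u) := by
  have := hasSum_sum (s := Finset.univ) fun (j : Fin 2) _ =>
    hasSum_sum (s := Finset.univ) fun (k : Fin 2) _ => (h.hasSum_fisher j k).mul_left (u j * u k)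
  refine hasSum_of_eq this (fun i => ?_) ?_
  · simp only [Fin.sum_univ_two]
    ring
  · simp only [dotProduct, mulVec, Fin.sum_univ_two]
    ring

lemma posSemidef (h : IsRegular p d) : (fisherMatrix p d).PosSemidef := by
  refine Matrix.PosSemidef.of_dotProduct_mulVec_nonneg ?_ fun u => ?_
  · ext j k
    simp only [Matrix.conjTranspose_apply, star_trivial]
    exact fisherMatrix_symm p d k j
  · rw [star_trivial]
    exact (h.hasSum_quadratic u).nonneg fun i => div_nonneg (sq_nonneg _) (h.nonneg i)

/-- If a direction carries no Fisher information, no estimator can follow it. -/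
lemma det_ne_zero (h : IsRegular p d) {T : ι → Fin 2 → ℝ}
    (hT : ∀ j k, HasSum (fun i => d k i * T i j) (if j = k then 1 else 0)) :
    (fisherMatrix p d).det ≠ 0 := by
  intro hdet
  obtain ⟨u, hu0, hu⟩ := Matrix.exists_mulVec_eq_zero_iff.mpr hdet
  have hq := h.hasSum_quadratic u
  rw [hu, dotProduct_zero] at hq
  have hz := (hasSum_zero_iff_of_nonneg fun i => div_nonneg (sq_nonneg _) (h.nonneg i)).mp hq
  have hdir (i : ι) : ∑ j, u j * d j i = 0 := by
    by_cases hp : p i = 0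
    · simp [h.deriv_eq_zero _ i hp]
    · have := congrFun hz i
      simpa [hp] using this
  apply hu0
  ext j
  have hs := hasSum_sum (s := Finset.univ) fun (k : Fin 2) _ => (hT j k).mul_left (u k)
  have hz' : (fun i => ∑ k, u k * (d k i * T i j)) = fun _ => 0 := by
    ext i
    have := hdir i
    simp only [Fin.sum_univ_two] at this ⊢
    linear_combination T i j * this
  rw [hz'] at hs
  simpa using hs.unique hasSum_zero

lemma inv_symm (p : ι → ℝ) (d : Fin 2 → ι → ℝ) :
    (fisherMatrix p d)⁻¹ᵀ = (fisherMatrix p d)⁻¹ := by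
  rw [Matrix.transpose_nonsing_inv]
  congr 1
  ext j k
  exact fisherMatrix_symm p d k j

lemma hasSum_score_mul_score (h : IsRegular p d) (hdet : (fisherMatrix p d).det ≠ 0)
    (j k : Fin 2) :
    HasSum (fun i => (∑ a, (fisherMatrix p d)⁻¹ j a * d a i) *
      (∑ a, (fisherMatrix p d)⁻¹ k a * d a i) / p i) ((fisherMatrix p d)⁻¹ j k) := by
  have h3 := hasSum_sum (s := Finset.univ) fun (a : Fin 2) _ =>
    hasSum_sum (s := Finset.univ) fun (b : Fin 2) _ =>
      (h.hasSum_fisher a b).mul_left ((fisherMatrix p d)⁻¹ j a * (fisherMatrix p d)⁻¹ k b)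
  refine hasSum_of_eq h3 (fun i => ?_) ?_
  · simp only [Fin.sum_univ_two]
    ring
  · have e : (fisherMatrix p d)⁻¹ * fisherMatrix p d * (fisherMatrix p d)⁻¹ᵀ
        = (fisherMatrix p d)⁻¹ := by
      rw [Matrix.nonsing_inv_mul _ (isUnit_iff_ne_zero.mpr hdet), Matrix.one_mul, inv_symm]
    conv_lhs => rw [← e]
    simp only [Matrix.mul_apply, Matrix.transpose_apply, Fin.sum_univ_two]
    ring

/-- The classical Cramér–Rao inequality: the difference `V - F⁻¹` is the second moment matrix of
the deviation of the estimator from the linear combination `F⁻¹ d / p` of the scores. -/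
lemma trace_le (h : IsRegular p d) {W : Matrix (Fin 2) (Fin 2) ℝ} (hW : W.PosSemidef)
    {θ : Fin 2 → ℝ} {T : ι → Fin 2 → ℝ} (hvar : ∀ j, Summable fun i => p i * T i j ^ 2)
    (hmean : ∀ j, HasSum (fun i => p i * T i j) (θ j))
    (hT : ∀ j k, HasSum (fun i => d k i * T i j) (if j = k then 1 else 0)) :
    (W * (fisherMatrix p d)⁻¹).trace ≤ (W * mseMatrix p θ T).trace := by
  have hdet := h.det_ne_zero hT
  set F := fisherMatrix p d with hF
  set G := F⁻¹ with hG
  have hGs (j k : Fin 2) : G j k = G k j := by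
    have := congrFun (congrFun (inv_symm p d) k) j
    rwa [← hF, ← hG, Matrix.transpose_apply] at this
  have hvar2 (j k : Fin 2) :
      Summable fun i => p i * ((T i j - θ j) * (T i k - θ k)) := by
    have hprod : Summable fun i => p i * (T i j * T i k) := by
      refine Summable.of_norm_bounded ((hvar j).add (hvar k)) fun i => ?_
      rw [Real.norm_eq_abs, abs_mul, abs_of_nonneg (h.nonneg i), ← mul_add]
      refine mul_le_mul_of_nonneg_left ?_ (h.nonneg i)
      rw [abs_le]
      constructor <;> nlinarith [sq_nonneg (T i j + T i k), sq_nonneg (T i j - T i k),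
        sq_nonneg (T i j), sq_nonneg (T i k)]
    refine (((hprod.sub ((hmean j).summable.mul_left (θ k))).sub
      ((hmean k).summable.mul_left (θ j))).add (h.hasSum.summable.mul_left (θ j * θ k))).congr
      fun i => ?_
    ring
  have hV (j k : Fin 2) : HasSum (fun i => p i * ((T i j - θ j) * (T i k - θ k)))
      (mseMatrix p θ T j k) := (hvar2 j k).hasSum
  have hτ (j k : Fin 2) : HasSum (fun i => d k i * (T i j - θ j)) (if j = k then 1 else 0) := by
    refine hasSum_of_eq ((hT j k).sub ((h.hasSum_deriv k).mul_left (θ j))) (fun i => ?_) ?_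
    · ring
    · rw [mul_zero, sub_zero]
  set r : ι → Fin 2 → ℝ := fun i j => T i j - θ j - (∑ k, G j k * d k i) / p i with hr
  have hrr (j k : Fin 2) :
      HasSum (fun i => p i * (r i j * r i k)) (mseMatrix p θ T j k - G j k) := by
    have h1 := hasSum_sum (s := Finset.univ) fun (a : Fin 2) _ => (hτ j a).mul_left (G k a)
    have h2 := hasSum_sum (s := Finset.univ) fun (a : Fin 2) _ => (hτ k a).mul_left (G j a)
    refine hasSum_of_eq ((((hV j k).sub h1).sub h2).add (h.hasSum_score_mul_score hdet j k))
      (fun i => ?_) ?_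
    · by_cases hp : p i = 0
      · simp [hp, h.deriv_eq_zero _ i hp]
      · simp only [hr, Fin.sum_univ_two, ← hF, ← hG]
        field_simp
        ring
    · simp only [mul_ite, mul_one, mul_zero, Finset.sum_ite_eq, Finset.mem_univ, if_true, ← hF,
        ← hG, hGs k j]
      ring
  have htot := hasSum_sum (s := Finset.univ) fun (j : Fin 2) _ =>
    hasSum_sum (s := Finset.univ) fun (k : Fin 2) _ => (hrr k j).mul_left (W j k)
  have hnn := htot.nonneg fun i => by
    have hq := hW.dotProduct_mulVec_nonneg (r i)
    have := mul_nonneg (h.nonneg i) hq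
    simp only [star_trivial, dotProduct, mulVec, Fin.sum_univ_two] at this ⊢
    linarith
  simp only [Matrix.trace_fin_two, Matrix.mul_apply, Fin.sum_univ_two] at hnn ⊢
  linarith

/-- The locally unbiased estimator `θ + F⁻¹ d / p`, which attains the Cramér–Rao bound. -/
def scoreEstimator (p : ι → ℝ) (d : Fin 2 → ι → ℝ) (θ : Fin 2 → ℝ) (i : ι) (j : Fin 2) : ℝ :=
  θ j + (∑ k, (fisherMatrix p d)⁻¹ j k * d k i) / p i

lemma summable_scoreEstimator (h : IsRegular p d) (hdet : (fisherMatrix p d).det ≠ 0)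
    (θ : Fin 2 → ℝ) (j : Fin 2) : Summable fun i => p i * scoreEstimator p d θ i j ^ 2 := by
  have h1 := hasSum_sum (s := Finset.univ) fun (a : Fin 2) _ =>
    (h.hasSum_deriv a).mul_left ((fisherMatrix p d)⁻¹ j a)
  refine (((h.hasSum.summable.mul_left (θ j ^ 2)).add (h1.summable.mul_left (2 * θ j))).add
    (h.hasSum_score_mul_score hdet j j).summable).congr fun i => ?_
  by_cases hp : p i = 0
  · simp [hp, h.deriv_eq_zero _ i hp]
  · simp only [scoreEstimator]
    field_simp
    ring

lemma hasSum_scoreEstimator (h : IsRegular p d) (θ : Fin 2 → ℝ) (j : Fin 2) :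
    HasSum (fun i => p i * scoreEstimator p d θ i j) (θ j) := by
  have h1 := hasSum_sum (s := Finset.univ) fun (a : Fin 2) _ =>
    (h.hasSum_deriv a).mul_left ((fisherMatrix p d)⁻¹ j a)
  refine hasSum_of_eq ((h.hasSum.mul_left (θ j)).add h1) (fun i => ?_) ?_
  · by_cases hp : p i = 0
    · simp [hp, h.deriv_eq_zero _ i hp]
    · simp only [scoreEstimator]
      field_simp
  · simp

lemma hasSum_deriv_mul_scoreEstimator (h : IsRegular p d) (hdet : (fisherMatrix p d).det ≠ 0)
    (θ : Fin 2 → ℝ) (j k : Fin 2) :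
    HasSum (fun i => d k i * scoreEstimator p d θ i j) (if j = k then 1 else 0) := by
  have h1 := hasSum_sum (s := Finset.univ) fun (a : Fin 2) _ =>
    (h.hasSum_fisher a k).mul_left ((fisherMatrix p d)⁻¹ j a)
  refine hasSum_of_eq (((h.hasSum_deriv k).mul_left (θ j)).add h1) (fun i => ?_) ?_
  · simp only [scoreEstimator, Fin.sum_univ_two]
    ring
  · rw [mul_zero, zero_add, ← Matrix.mul_apply,
      Matrix.nonsing_inv_mul _ (isUnit_iff_ne_zero.mpr hdet), Matrix.one_apply]

lemma mseMatrix_scoreEstimator (h : IsRegular p d) (hdet : (fisherMatrix p d).det ≠ 0)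
    (θ : Fin 2 → ℝ) : mseMatrix p θ (scoreEstimator p d θ) = (fisherMatrix p d)⁻¹ := by
  ext j k
  rw [← (h.hasSum_score_mul_score hdet j k).tsum_eq]
  refine tsum_congr fun i => ?_
  by_cases hp : p i = 0
  · simp [hp]
  · simp only [scoreEstimator]
    field_simp
    ring

end IsRegular

end ClassicalCramerRao

/-! ### The bound in normal coordinates -/

section Assembly

variable {ψ : (Fin 2 → ℝ) → H} {θ : Fin 2 → ℝ} {W A : Matrix (Fin 2) (Fin 2) ℝ}
  {s₁ s₂ β η : ℝ} {e : Fin 2 → H}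

/-- The model in normal coordinates given by the columns of `A`: the score vectors `e 0, e 1` are
unit vectors with inner product `i β`, and the weight is diagonal. -/
structure NormalForm (ψ : (Fin 2 → ℝ) → H) (θ : Fin 2 → ℝ) (W : Matrix (Fin 2) (Fin 2) ℝ)
    (s₁ s₂ β : ℝ) (A : Matrix (Fin 2) (Fin 2) ℝ) (e : Fin 2 → H) : Prop where
  isUnit_det : IsUnit A.det
  norm_eq : ‖ψ θ‖ = 1
  inner_state : ∀ j, ⟪ψ θ, e j⟫_ℂ = 0
  inner_self : ∀ j, ⟪e j, e j⟫_ℂ = 1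
  inner_eq : ⟪e 0, e 1⟫_ℂ = β * Complex.I
  weight : Aᵀ * W * A = !![s₁, 0; 0, s₂]
  regular : ∀ {ι : Type} (M : POVM ι H),
    IsRegular (fun i => prob ψ M i θ) (fun j i => pderiv (prob ψ M i) θ j)
  fisher_eq : ∀ {ι : Type} (M : POVM ι H),
    Aᵀ * fisher ψ θ M * A = Matrix.of fun a b => fisherForm M (ψ θ) (e a) (e b)

lemma fisher_eq_fisherMatrix {ι : Type} (M : POVM ι H) :
    fisher ψ θ M
      = fisherMatrix (fun i => prob ψ M i θ) (fun j i => pderiv (prob ψ M i) θ j) := rfl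

lemma inner_sum_sum (l : Fin 2 → H) (A : Matrix (Fin 2) (Fin 2) ℝ) (a b : Fin 2) :
    ⟪∑ j, (A j a : ℂ) • l j, ∑ k, (A k b : ℂ) • l k⟫_ℂ
      = ((Aᵀ * (Matrix.of fun j k => (⟪l j, l k⟫_ℂ).re) * A) a b : ℝ)
        + ((Aᵀ * (Matrix.of fun j k => (⟪l j, l k⟫_ℂ).im) * A) a b : ℝ) * Complex.I := by
  apply Complex.ext
  all_goals
    simp only [Fin.sum_univ_two, inner_add_left, inner_add_right, inner_smul_left,
      inner_smul_right, Complex.conj_ofReal, Matrix.mul_apply, Matrix.transpose_apply,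
      Matrix.of_apply, Complex.add_re, Complex.add_im, Complex.re_ofReal_mul,
      Complex.im_ofReal_mul, Complex.ofReal_re, Complex.ofReal_im, Complex.I_re, Complex.I_im]
    ring

lemma isRegular_prob [CompleteSpace H] {L : Fin 2 → H →L[ℂ] H} (hL : IsSLD ψ θ L)
    (hnorm : ∀ᶠ ϑ in nhds θ, ‖ψ ϑ‖ = 1) (hdiff : DifferentiableAt ℝ ψ θ) {ι : Type}
    (M : POVM ι H) :
    IsRegular (fun i => prob ψ M i θ) (fun j i => pderiv (prob ψ M i) θ j) where
  nonneg i := inner_apply_self_re_nonneg (M.pos i) (ψ θ)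
  hasSum := by
    have h := M.hasSum_inner_re (ψ θ) (ψ θ)
    rw [inner_self_eq_norm_sq_to_K, hnorm.self_of_nhds] at h
    simpa [prob] using h
  hasSum_deriv j := by
    simp only [hL.pderiv_prob hnorm hdiff M]
    have h := M.hasSum_inner_re (ψ θ) (L j (ψ θ))
    rwa [hL.inner_apply_self hnorm hdiff, Complex.zero_re] at h
  deriv_eq_zero j i hp := by
    have h := cauchySchwarz (M.pos i) (ψ θ) (L j (ψ θ))
    rw [show (⟪ψ θ, M.effect i (ψ θ)⟫_ℂ).re = 0 from hp, zero_mul] at h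
    rw [hL.pderiv_prob hnorm hdiff M]
    nlinarith [sq_nonneg (⟪ψ θ, M.effect i (L j (ψ θ))⟫_ℂ).re,
      sq_nonneg (⟪ψ θ, M.effect i (L j (ψ θ))⟫_ℂ).im]
  summable j k := by
    simp only [hL.pderiv_prob hnorm hdiff M]
    exact summable_fisher M (ψ θ) (L j (ψ θ)) (L k (ψ θ))

lemma exists_normalForm [CompleteSpace H] {L : Fin 2 → H →L[ℂ] H} (hL : IsSLD ψ θ L)
    (hnorm : ∀ᶠ ϑ in nhds θ, ‖ψ ϑ‖ = 1) (hdiff : DifferentiableAt ℝ ψ θ)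
    (hJ : (qfi (ψ θ) L).PosDef) (hW : W.IsHermitian)
    (hs : (invSqrt (qfi (ψ θ) L) * W * invSqrt (qfi (ψ θ) L)).charpoly.roots = {s₁, s₂}) :
    ∃ A e, NormalForm ψ θ W s₁ s₂ (incompat (qfi (ψ θ) L) (qfiIm (ψ θ) L)) A e := by
  have hJl : qfi (ψ θ) L
      = Matrix.of fun j k => (⟪L j (ψ θ), L k (ψ θ)⟫_ℂ).re := by
    ext j k; simp only [qfi, Matrix.of_apply, hL.inner_apply_left]
  have hJtl : qfiIm (ψ θ) L
      = Matrix.of fun j k => (⟪L j (ψ θ), L k (ψ θ)⟫_ℂ).im := by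
    ext j k; simp only [qfiIm, Matrix.of_apply, hL.inner_apply_left]
  have hanti : (qfiIm (ψ θ) L)ᵀ = -qfiIm (ψ θ) L := by
    rw [hJtl]
    ext j k
    simp only [Matrix.transpose_apply, Matrix.of_apply, Matrix.neg_apply]
    exact inner_im_symm (𝕜 := ℂ) _ _
  obtain ⟨A, h1, h2, h3⟩ := exists_normal_coordinates hJ hanti hW hs
  have hinner (a b : Fin 2) := inner_sum_sum (fun j => L j (ψ θ)) A a b
  simp only [← hJl, ← hJtl, h1, h3] at hinner
  refine ⟨A, fun a => ∑ j, (A j a : ℂ) • L j (ψ θ), ?_, hnorm.self_of_nhds, fun a => ?_,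
    fun a => ?_, ?_, h2, isRegular_prob hL hnorm hdiff, fun {ι} M => ?_⟩
  · have := congrArg Matrix.det h1
    rw [Matrix.det_mul, Matrix.det_one, mul_comm] at this
    exact IsUnit.of_mul_eq_one _ this
  · simp only [inner_sum, inner_smul_right, hL.inner_apply_self hnorm hdiff, mul_zero,
      Finset.sum_const_zero]
  · rw [hinner]
    fin_cases a <;> simp
  · rw [hinner]
    simp
  · ext a b
    rw [Matrix.of_apply, fisherForm_sum_sum]
    simp only [fisher, fisherForm, prob, ← hL.pderiv_prob hnorm hdiff M]

lemma mostInformativeBound_le_classicalBound {ι : Type} (M : POVM ι H) :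
    mostInformativeBound ψ θ W ≤ classicalBound W (fisher ψ θ M) :=
  (iInf_le (fun ι : Type => ⨅ M : POVM ι H, classicalBound W (fisher ψ θ M)) ι).trans
    (iInf_le (fun M : POVM ι H => classicalBound W (fisher ψ θ M)) M)

namespace NormalForm

lemma nonneg (h : NormalForm ψ θ W s₁ s₂ β A e) (hW : W.PosSemidef) : 0 ≤ s₁ ∧ 0 ≤ s₂ := by
  have hD : (!![s₁, 0; 0, s₂] : Matrix (Fin 2) (Fin 2) ℝ).PosSemidef := by
    rw [← h.weight, ← Matrix.conjTranspose_eq_transpose_of_trivial]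
    exact hW.conjTranspose_mul_mul_same A
  exact ⟨hD.diag_nonneg (i := 0), hD.diag_nonneg (i := 1)⟩

lemma pos (h : NormalForm ψ θ W s₁ s₂ β A e) (hW : W.PosDef) : 0 < s₁ ∧ 0 < s₂ := by
  have hdet : s₁ * s₂ ≠ 0 := by
    have hd := congrArg Matrix.det h.weight
    rw [Matrix.det_mul, Matrix.det_mul, Matrix.det_transpose, Matrix.det_fin_two_of] at hd
    have hA := h.isUnit_det.ne_zero
    have := mul_ne_zero (mul_ne_zero hA hW.det_pos.ne') hA
    rw [hd] at this
    simpa using this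
  obtain ⟨h1, h2⟩ := h.nonneg hW.posSemidef
  exact ⟨lt_of_le_of_ne h1 (left_ne_zero_of_mul hdet).symm,
    lt_of_le_of_ne h2 (right_ne_zero_of_mul hdet).symm⟩

lemma le_one (h : NormalForm ψ θ W s₁ s₂ β A e) : β ≤ 1 := by
  have hn (j : Fin 2) : ‖e j‖ = 1 := by
    have := h.inner_self j
    rw [inner_self_eq_norm_sq_to_K] at this
    have h2 : ‖e j‖ ^ 2 = 1 := Complex.ofReal_injective (by simpa using this)
    exact (pow_eq_one_iff_of_nonneg (norm_nonneg _) two_ne_zero).mp h2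
  have hc := norm_inner_le_norm (𝕜 := ℂ) (e 0) (e 1)
  rw [h.inner_eq, hn, hn, norm_mul, Complex.norm_I, Complex.norm_real, mul_one, mul_one] at hc
  exact (le_abs_self β).trans hc

/-- Every measurement obeys the bound for some distribution `φ` of the incompatibility. -/
lemma exists_objective_le (h : NormalForm ψ θ W s₁ s₂ β A e) (hW : W.PosSemidef)
    (hη0 : 0 ≤ η) (hη : η ≤ Real.pi / 4) (hsin : Real.sin (2 * η) = β) {ι : Type}
    (M : POVM ι H) :
    ∃ φ ∈ Set.Icc (-η) η, objective s₁ s₂ η φ ≤ classicalBound W (fisher ψ θ M) := by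
  -- a singular Fisher information matrix has the bound `∞`
  by_cases hdet : (fisher ψ θ M).det = 0
  · exact ⟨0, ⟨by linarith, hη0⟩, by rw [classicalBound, if_pos hdet]; exact le_top⟩
  obtain ⟨hs₁, hs₂⟩ := h.nonneg hW
  have hps : (Aᵀ * fisher ψ θ M * A).PosSemidef := by
    rw [← Matrix.conjTranspose_eq_transpose_of_trivial]
    exact (h.regular M).posSemidef.conjTranspose_mul_mul_same A
  have hdet' : (Aᵀ * fisher ψ θ M * A).det ≠ 0 := by
    rw [Matrix.det_mul, Matrix.det_mul, Matrix.det_transpose]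
    exact mul_ne_zero (mul_ne_zero h.isUnit_det.ne_zero hdet) h.isUnit_det.ne_zero
  obtain ⟨hf₁, hf₂, hle⟩ := div_add_div_le_trace hps hdet' hs₁ hs₂
  rw [← h.weight, ← trace_mul_inv_eq h.isUnit_det, h.fisher_eq] at hle
  rw [h.fisher_eq] at hf₁ hf₂
  simp only [Matrix.of_apply] at hle hf₁ hf₂
  have hle1 (j : Fin 2) : fisherForm M (ψ θ) (e j) (e j) ≤ 1 := by
    have := fisherForm_self_le M (ψ θ) (e j)
    rwa [h.inner_self, Complex.one_re] at this
  obtain ⟨φ, hφ, h1, h2⟩ := exists_angle hη0 hη hf₁.le (hle1 0) hf₂.le (hle1 1)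
    fun a b ha hb hab => by
      have := fisherForm_tradeoff M (ψ θ) (e 0) (e 1) ha hb hab
      rw [h.inner_self, h.inner_self, h.inner_eq, Complex.one_re, Complex.im_ofReal_mul,
        Complex.I_im, mul_one] at this
      rwa [hsin]
  refine ⟨φ, hφ, (objective_le hs₁ hs₂ hf₁ hf₂ h1 h2).trans ?_⟩
  rw [classicalBound, if_neg hdet]
  exact ENNReal.ofReal_le_ofReal hle

/-- Every distribution `φ` with nonvanishing denominators is realized by a measurement with four
outcomes. -/
lemma exists_povm (h : NormalForm ψ θ W s₁ s₂ β A e) (hW : W.PosSemidef)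
    (hsin : Real.sin (2 * η) = β) {φ : ℝ} (hc₁ : Real.cos (φ - η) ≠ 0)
    (hc₂ : Real.cos (φ + η) ≠ 0) :
    ∃ M : POVM (Option (Fin 3)) H, (fisher ψ θ M).det ≠ 0 ∧
      classicalBound W (fisher ψ θ M) = objective s₁ s₂ η φ := by
  obtain ⟨hs₁, hs₂⟩ := h.nonneg hW
  obtain ⟨g₁, g₂, hv, hB, h11, h12, h21, h22⟩ :=
    exists_measurement_vectors (α₁ := η - φ) (α₂ := φ + η) (h.inner_self 0) (h.inner_self 1)
      h.inner_eq (by rw [← hsin]; ring_nf)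
  obtain ⟨hg₁, hg₂⟩ := hv (ψ θ) (h.inner_state 0) (h.inner_state 1)
  rw [← neg_sub, Real.cos_neg] at h11
  have hF := h.fisher_eq (framePOVM (ψ θ) g₁ g₂ (bessel_frame h.norm_eq hg₁ hg₂ hB))
  have hF' : Aᵀ * fisher ψ θ (framePOVM (ψ θ) g₁ g₂ (bessel_frame h.norm_eq hg₁ hg₂ hB)) * A
      = !![Real.cos (φ - η) ^ 2, 0; 0, Real.cos (φ + η) ^ 2] := by
    rw [hF]
    ext a b
    rw [Matrix.of_apply, fisherForm_framePOVM _ h.norm_eq hg₁ hg₂ (h.inner_state a)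
      (h.inner_state b)]
    fin_cases a <;> fin_cases b <;> simp [h11, h12, h21, h22, sq]
  set M := framePOVM (ψ θ) g₁ g₂ (bessel_frame h.norm_eq hg₁ hg₂ hB)
  have hdet : (fisher ψ θ M).det ≠ 0 := by
    intro h0
    have hd := congrArg Matrix.det hF'
    rw [Matrix.det_mul, Matrix.det_mul, h0, mul_zero, zero_mul, Matrix.det_fin_two_of] at hd
    have : Real.cos (φ - η) ^ 2 * Real.cos (φ + η) ^ 2 ≠ 0 := by positivity
    apply this
    linarith
  refine ⟨M, hdet, ?_⟩
  rw [classicalBound, if_neg hdet, objective_eq_ofReal hs₁ hs₂ hc₁ hc₂,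
    trace_mul_inv_eq h.isUnit_det, hF', h.weight]
  congr 1
  rw [Matrix.inv_def, Ring.inverse_eq_inv', Matrix.adjugate_fin_two, Matrix.det_fin_two_of]
  simp [Matrix.trace_fin_two]
  field_simp

lemma mostInformativeBound_le (h : NormalForm ψ θ W s₁ s₂ β A e) (hW : W.PosSemidef)
    (hη0 : 0 ≤ η) (hη : η ≤ Real.pi / 4) (hsin : Real.sin (2 * η) = β) {φ : ℝ}
    (hφ : φ ∈ Set.Icc (-η) η) : mostInformativeBound ψ θ W ≤ objective s₁ s₂ η φ := by
  have hp := Real.pi_pos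
  have hreg (t : ℝ) (h1 : Real.cos (t - η) ≠ 0) (h2 : Real.cos (t + η) ≠ 0) :
      mostInformativeBound ψ θ W ≤ objective s₁ s₂ η t := by
    obtain ⟨M, -, hM⟩ := h.exists_povm hW hsin h1 h2
    rw [← hM]
    exact mostInformativeBound_le_classicalBound M
  rcases hη0.eq_or_lt with h0 | h0
  · subst h0
    have : φ = 0 := by have h1 := hφ.1; have h2 := hφ.2; linarith
    subst this
    exact hreg 0 (by simp) (by simp)
  -- in the interior the denominators do not vanish; the end points follow by continuity
  · have hcl : IsClosed {t | mostInformativeBound ψ θ W ≤ objective s₁ s₂ η t} :=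
      isClosed_le continuous_const (continuous_objective s₁ s₂ η)
    have hsub : Set.Ioo (-η) η ⊆ {t | mostInformativeBound ψ θ W ≤ objective s₁ s₂ η t} :=
      fun t ht => hreg t
        (Real.cos_pos_of_mem_Ioo ⟨by linarith [ht.1], by linarith [ht.2]⟩).ne'
        (Real.cos_pos_of_mem_Ioo ⟨by linarith [ht.1], by linarith [ht.2]⟩).ne'
    rw [← closure_Ioo (by linarith : -η ≠ η)] at hφ
    exact closure_minimal hsub hcl hφ

lemma isLeast (h : NormalForm ψ θ W s₁ s₂ β A e) (hW : W.PosSemidef)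
    (hη0 : 0 ≤ η) (hη : η ≤ Real.pi / 4) (hsin : Real.sin (2 * η) = β) :
    IsLeast (objective s₁ s₂ η '' Set.Icc (-η) η) (mostInformativeBound ψ θ W) := by
  obtain ⟨φ, hφ, hmin⟩ := (isCompact_Icc (a := -η) (b := η)).exists_isMinOn
    ⟨0, by linarith, hη0⟩ (continuous_objective s₁ s₂ η).continuousOn
  refine ⟨⟨φ, hφ, le_antisymm (le_iInf₂ fun ι M => ?_) ?_⟩, ?_⟩
  · obtain ⟨t, ht, hle⟩ := h.exists_objective_le hW hη0 hη hsin M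
    exact (hmin ht).trans hle
  · exact h.mostInformativeBound_le hW hη0 hη hsin hφ
  · rintro _ ⟨t, ht, rfl⟩
    exact h.mostInformativeBound_le hW hη0 hη hsin ht

lemma classicalBound_le (h : NormalForm ψ θ W s₁ s₂ β A e) (hW : W.PosSemidef) {ι : Type}
    {M : POVM ι H} {T : ι → Fin 2 → ℝ} (hT : LocallyUnbiased ψ θ M T) :
    classicalBound W (fisher ψ θ M) ≤ ENNReal.ofReal (W * mse ψ θ M T).trace := by
  have hdet : (fisher ψ θ M).det ≠ 0 := (h.regular M).det_ne_zero hT.deriv_mean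
  rw [classicalBound, if_neg hdet]
  exact ENNReal.ofReal_le_ofReal
    ((h.regular M).trace_le hW hT.finite_variance hT.mean hT.deriv_mean)

lemma exists_locallyUnbiased (h : NormalForm ψ θ W s₁ s₂ β A e) {ι : Type}
    (M : POVM ι H) (hdet : (fisher ψ θ M).det ≠ 0) :
    ∃ T, LocallyUnbiased ψ θ M T ∧
      ENNReal.ofReal (W * mse ψ θ M T).trace = classicalBound W (fisher ψ θ M) := by
  have hr := h.regular M
  refine ⟨IsRegular.scoreEstimator _ _ θ, ⟨hr.summable_scoreEstimator hdet θ,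
    hr.hasSum_scoreEstimator θ, hr.hasSum_deriv_mul_scoreEstimator hdet θ⟩, ?_⟩
  rw [classicalBound, if_neg hdet]
  have := hr.mseMatrix_scoreEstimator hdet θ
  rw [fisher_eq_fisherMatrix, ← this]
  rfl

lemma optimalError_eq (h : NormalForm ψ θ W s₁ s₂ β A e) (hW : W.PosSemidef) :
    optimalError ψ θ W = mostInformativeBound ψ θ W := by
  refine le_antisymm (le_iInf₂ fun ι M => ?_)
    (le_iInf fun ι => le_iInf fun M => le_iInf fun T => le_iInf fun hT =>
      (mostInformativeBound_le_classicalBound M).trans (h.classicalBound_le hW hT))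
  by_cases hdet : (fisher ψ θ M).det = 0
  · rw [classicalBound, if_pos hdet]; exact le_top
  · obtain ⟨T, hT, heq⟩ := h.exists_locallyUnbiased M hdet
    rw [← heq]
    exact iInf_le_of_le ι (iInf_le_of_le M (iInf_le_of_le T (iInf_le_of_le hT le_rfl)))

end NormalForm

end Assembly

end TwoParam

end

theorem mainTheorem3 {H : Type*} [NormedAddCommGroup H] [InnerProductSpace ℂ H] [CompleteSpace H]
    (ψ : (Fin 2 → ℝ) → H) (θ : Fin 2 → ℝ)
    (hnorm : ∀ᶠ ϑ in nhds θ, ‖ψ ϑ‖ = 1) (hdiff : DifferentiableAt ℝ ψ θ)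
    (L : Fin 2 → H →L[ℂ] H) (hL : TwoParam.IsSLD ψ θ L)
    (J : Matrix (Fin 2) (Fin 2) ℝ) (hJ : J = TwoParam.qfi (ψ θ) L) (hJpos : J.PosDef)
    (W : Matrix (Fin 2) (Fin 2) ℝ) (hW : W.PosSemidef)
    (s₁ s₂ : ℝ)
    (hs : (TwoParam.invSqrt J * W * TwoParam.invSqrt J).charpoly.roots = {s₁, s₂})
    (β : ℝ) (hβ : β = TwoParam.incompat J (TwoParam.qfiIm (ψ θ) L))
    (η : ℝ) (hη : η = Real.arcsin β / 2) :
    0 ≤ β ∧ β ≤ 1 ∧ 0 ≤ s₁ ∧ 0 ≤ s₂ ∧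
    -- the bound, as a finite minimum over `φ`
    TwoParam.mostInformativeBound ψ θ W ≠ ⊤ ∧
    IsLeast (TwoParam.objective s₁ s₂ η '' Set.Icc (-η) η)
      (TwoParam.mostInformativeBound ψ θ W) ∧
    -- it is the tightest lower bound on the weighted error of locally unbiased estimation
    TwoParam.optimalError ψ θ W = TwoParam.mostInformativeBound ψ θ W ∧
    -- attainability by a measurement and a locally unbiased estimator
    (β < 1 ∨ W.PosDef →
      (∃ (ι : Type) (_ : Finite ι) (M : TwoParam.POVM ι H) (T : ι → Fin 2 → ℝ),
        TwoParam.classicalBound W (TwoParam.fisher ψ θ M) =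
            TwoParam.mostInformativeBound ψ θ W ∧
          TwoParam.LocallyUnbiased ψ θ M T ∧
          ENNReal.ofReal (W * TwoParam.mse ψ θ M T).trace =
            TwoParam.mostInformativeBound ψ θ W)) ∧
    -- every minimizer solves the quartic equation
    (∀ φ ∈ Set.Icc (-η) η,
      TwoParam.objective s₁ s₂ η φ = TwoParam.mostInformativeBound ψ θ W →
        |Real.tan φ| ≤ Real.tan η ∧ TwoParam.quartic s₁ s₂ η (Real.tan φ) = 0) := by
  subst hJ
  obtain ⟨A, e, h⟩ := TwoParam.exists_normalForm hL hnorm hdiff hJpos hW.isHermitian hs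
  rw [← hβ] at h
  have hβ0 : 0 ≤ β := by rw [hβ]; exact ENNReal.toReal_nonneg
  have hβ1 : β ≤ 1 := h.le_one
  obtain ⟨hs₁, hs₂⟩ := h.nonneg hW
  have hη0 : 0 ≤ η := by
    rw [hη]; exact div_nonneg (Real.arcsin_nonneg.mpr hβ0) zero_le_two
  have hη1 : η ≤ Real.pi / 4 := by
    rw [hη]; linarith [Real.arcsin_le_pi_div_two β]
  have h2η : 2 * η = Real.arcsin β := by rw [hη]; ring
  have hsin : Real.sin (2 * η) = β := by rw [h2η, Real.sin_arcsin (by linarith) hβ1]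
  have hp := Real.pi_pos
  have hleast := h.isLeast hW hη0 hη1 hsin
  have hfin : TwoParam.mostInformativeBound ψ θ W ≠ ⊤ := by
    have hc : Real.cos η ≠ 0 := (Real.cos_pos_of_mem_Ioo ⟨by linarith, by linarith⟩).ne'
    refine ne_top_of_le_ne_top ?_ (hleast.2 ⟨0, ⟨by linarith, hη0⟩, rfl⟩)
    rw [TwoParam.objective_eq_ofReal hs₁ hs₂ (by rwa [zero_sub, Real.cos_neg])
      (by rwa [zero_add])]
    exact ENNReal.ofReal_ne_top
  refine ⟨hβ0, hβ1, hs₁, hs₂, hfin, hleast, h.optimalError_eq hW, fun hor => ?_,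
    fun φ hφ heq => ⟨TwoParam.abs_tan_le (by linarith) hφ, ?_⟩⟩
  · obtain ⟨φ, hφ, heq⟩ := hleast.1
    have hc : Real.cos (φ - η) ≠ 0 ∧ Real.cos (φ + η) ≠ 0 := by
      rcases hor with hlt | hWp
      · have hlt' : 2 * η < Real.pi / 2 := by rw [h2η]; exact Real.arcsin_lt_pi_div_two.mpr hlt
        exact ⟨(Real.cos_pos_of_mem_Ioo ⟨by linarith [hφ.1], by linarith [hφ.2]⟩).ne',
          (Real.cos_pos_of_mem_Ioo ⟨by linarith [hφ.1], by linarith [hφ.2]⟩).ne'⟩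
      · have hcos := TwoParam.cos_ne_zero_of_objective_ne_top (heq ▸ hfin)
        exact ⟨hcos.1 (h.pos hWp).1, hcos.2 (h.pos hWp).2⟩
    obtain ⟨M, hdet, hM⟩ := h.exists_povm hW hsin hc.1 hc.2
    obtain ⟨T, hT, hmse⟩ := h.exists_locallyUnbiased M hdet
    exact ⟨Option (Fin 3), inferInstance, M, T, hM.trans heq, hT, hmse.trans (hM.trans heq)⟩
  · refine TwoParam.quartic_eq_zero_of_isMinOn hs₁ hs₂ hη0 hη1 hφ (fun t ht => ?_) (heq ▸ hfin)
    rw [heq]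
    exact hleast.2 ⟨t, ht, rfl⟩
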